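/- Let $\Omega$ be either a nonempty open interval of $\mathbb{R}$ (bounded or unbounded) or a circle $\mathbb{R}/L\mathbb{Z}$ with $L>0$. For $w\in L^2(\Omega)$ put $$TV(w)=\sup\Big\{-\int_\Omega w\,\varphi'\,dx \;:\; \varphi\in C_c^\infty(\Omega),\ |\varphi|\le 1\Big\}\in[0,\infty],$$ and for $w$ with $TV(w)<\infty$ let $Dw$ denote the distributional derivative of $w$, which is a finite signed measure on $\Omega$, and $|Dw|$ its total variation measure. Let $u_0\in L^2(\Omega)$ with $TV(u_0)<\infty$ (for instance, any $u_0\in BV(\Omega)$), and let $u$ be the solution to the total variation flow on $\Omega$ with initial datum $u_0$, that is: $u\in C([0,\infty),L^2(\Omega))$, $u_t\in L^2((\delta,\infty),L^2(\Omega))$ for every $\delta>0$, $u(0)=u_0$, and $u_t(t)\in-\partial_{L^2}TV(u(t))$ for almost every $t>0$, where $\partial_{L^2}TV(w)=\{f\in L^2(\Omega): TV(w+h)-TV(w)\ge (h,f)_{L^2}\ \text{for all } h\in L^2(\Omega)\}$ if $TV(w)<\infty$ and $\partial_{L^2}TV(w)=\emptyset$ otherwise. Then for every $t>0$ the distributional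 derivative $Du(t)$ is a finite signed measure on $\Omega$, and $$|Du(t)|\le|Du_0|\quad\text{as measures on }\Omega.$$ -/

import Mathlib

open MeasureTheory Set
open scoped ContDiff

attribute [local instance] Measure.Subtype.measureSpace

noncomputable section

namespace TVFlow

/-! ### Gradient flows of convex functionals on a real Hilbert space -/

section GradientFlow

variable {H : Type*} [NormedAddCommGroup H] [InnerProductSpace ℝ H]

/-- The subdifferential of `E : H → (-∞, ∞]` at `v`: it is empty unless `E v < ∞`, and otherwise
consists of all `f` with `E (v + h) - E v ≥ (h, f)` for every `h`. -/
def subdifferential (E : H → EReal) (v : H) : Set H :=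
  {f | E v < ⊤ ∧ ∀ h : H, E v + ((inner ℝ h f : ℝ) : EReal) ≤ E (v + h)}

/-- `u ∈ C([0,∞), H)` with `u_t ∈ L²((δ,∞), H)` for every `δ > 0`, `u_t ∈ -∂E(u)` for almost every
`t > 0` and `u(0) = u₀`. The weak time derivative `u_t` is the function `v`: being the weak
derivative of the continuous curve `u` on `(0,∞)` means `u(t) - u(s) = ∫ₛᵗ v`. -/
structure IsGradientFlow (E : H → EReal) (u₀ : H) (u : ℝ → H) : Prop where
  continuousOn : ContinuousOn u (Ici 0)
  initial : u 0 = u₀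
  exists_deriv : ∃ v : ℝ → H,
    (∀ δ : ℝ, 0 < δ → MemLp v 2 (volume.restrict (Ioi δ))) ∧
    (∀ s t : ℝ, 0 < s → s ≤ t → u t - u s = ∫ r in s..t, v r) ∧
    (∀ᵐ t ∂(volume.restrict (Ioi (0 : ℝ))), -(v t) ∈ subdifferential E (u t))

end GradientFlow

/-! ### Test functions on one-dimensional domains

A test function is recorded together with its derivative, as a pair `(φ, φ')`. -/

/-- The pairs `(φ, φ')` with `φ ∈ C_c^∞(Ω)`, for a set `Ω` of reals (open, in all uses). -/
def intervalTests (Ω : Set ℝ) : Set ((Ω → ℝ) × (Ω → ℝ)) :=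
  {p | ∃ φ : ℝ → ℝ, ContDiff ℝ ∞ φ ∧ HasCompactSupport φ ∧ tsupport φ ⊆ Ω ∧
    (∀ x : Ω, p.1 x = φ x) ∧ ∀ x : Ω, p.2 x = deriv φ x}

/-- The pairs `(φ, φ')` with `φ ∈ C^∞(ℝ/Lℤ)`. -/
def circleTests (L : ℝ) : Set ((AddCircle L → ℝ) × (AddCircle L → ℝ)) :=
  {p | ContDiff ℝ ∞ (fun x : ℝ => p.1 (x : AddCircle L)) ∧
    ∀ x : ℝ, p.2 (x : AddCircle L) = deriv (fun y : ℝ => p.1 (y : AddCircle L)) x}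

/-! ### Total variation and the distributional derivative as a measure -/

section BV

variable {X : Type*} [MeasureSpace X]

/-- `TV(u) = sup { -∫ u φ' : φ a test function, |φ| ≤ 1 }`, as a functional on `L²`. -/
def totalVariation (T : Set ((X → ℝ) × (X → ℝ))) (u : Lp ℝ 2 (volume : Measure X)) : EReal :=
  ⨆ p ∈ {p ∈ T | ∀ x, |p.1 x| ≤ 1}, ((-∫ x, u x * p.2 x : ℝ) : EReal)

/-- The integral of `φ` against a signed measure. -/
def signedIntegral (φ : X → ℝ) (ν : SignedMeasure X) : ℝ :=
  (∫ x, φ x ∂ν.toJordanDecomposition.posPart) - ∫ x, φ x ∂ν.toJordanDecomposition.negPart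

/-- The distributional derivative `Du` is the finite signed measure `ν`:
`∫ u φ' = -∫ φ dν` for every test function `φ`. -/
def HasDerivMeasure (T : Set ((X → ℝ) × (X → ℝ))) (u : Lp ℝ 2 (volume : Measure X))
    (ν : SignedMeasure X) : Prop :=
  ∀ p ∈ T, ∫ x, u x * p.2 x = -signedIntegral p.1 ν

/-- `u` is the solution of the total variation flow with initial datum `u₀`: the gradient flow of
`TV` in `L²`. -/
def IsTVFlow (T : Set ((X → ℝ) × (X → ℝ))) (u₀ : Lp ℝ 2 (volume : Measure X))
    (u : ℝ → Lp ℝ 2 (volume : Measure X)) : Prop :=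
  IsGradientFlow (totalVariation T) u₀ u

end BV

end TVFlow

end

/-! For a finite measure `μ`, the set `K = derivBoundedBy μ` of all `w ∈ L²` with `|Dw| ≤ μ` is
closed and convex. The theorem amounts to the invariance of `K` under the flow when `μ = |Du₀|`.

A closed convex `K` is invariant under a gradient flow once `(w - P w, f) ≥ 0` for every subgradient
`f` at `w`, `P` being the projection onto `K`: the distance to `K` cannot grow
(`IsGradientFlow.mem_of_convex`). For `TV` this sign follows from the invariance of `K` under the
resolvent, by monotonicity tested between `w` and the resolvent of `P w` as the step tends to `0`
(`inner_subdifferential_nonneg`).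

The heart is the resolvent (`mem_derivBoundedBy_of_resolvent`). Formally `u = f - l ψ'`, where `|ψ|
≤ 1` and `ψ` maximises `∫ u ψ'`. Maximality places the positive part of `-Du` on `{ψ = 1}`; there
`ψ` is at its maximum, so `ψ'' ≤ 0` and `-Du = -Df + l ψ'' ≤ |Df|`. The other sign follows by
symmetry. Since `ψ'` is only an `L²` limit `p` of derivatives of test functions, the indicator of
`{ψ = 1}` is replaced by `peak k (ψ)`, with `k → ∞` at the end.

Bounds on functionals become signed measures through Hahn-Banach and Riesz representation. -/

open Filter Topology

/-! ### Abstract test spaces and the convex set of functions with dominated derivative. -/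

namespace TVFlow

/-- The properties of the space of pairs `(φ, φ')`, `φ` a smooth compactly supported function on a
one-dimensional domain, on which the estimates of this file rest. -/
structure IsTestSpace {X : Type*} [MeasureSpace X] [TopologicalSpace X]
    (T : Set ((X → ℝ) × (X → ℝ))) : Prop where
  continuous_fst : ∀ {p}, p ∈ T → Continuous p.1
  hasCompactSupport_fst : ∀ {p}, p ∈ T → HasCompactSupport p.1
  zero_mem : (0 : (X → ℝ) × (X → ℝ)) ∈ T
  add_mem : ∀ {p q}, p ∈ T → q ∈ T → p + q ∈ T
  smul_mem : ∀ (c : ℝ) {p}, p ∈ T → c • p ∈ T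
  mul_comp_mem : ∀ {p q} (g : ℝ → ℝ), p ∈ T → q ∈ T → ContDiff ℝ ∞ g →
    ((fun x => p.1 x * g (q.1 x),
      fun x => p.2 x * g (q.1 x) + p.1 x * (deriv g (q.1 x) * q.2 x)) :
      (X → ℝ) × (X → ℝ)) ∈ T
  exists_deriv_mem : ∀ {p}, p ∈ T → ∃ r, (p.2, r) ∈ T
  integral_deriv : ∀ {p}, p ∈ T → ∫ x, p.2 x = 0
  exists_cutoff : ∀ {p}, p ∈ T → ∃ q ∈ T, (∀ x, 0 ≤ q.1 x) ∧ (∀ x, q.1 x ≤ 1) ∧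
    ∀ x, p.1 x ≠ 0 → q.1 x = 1

namespace IsTestSpace

variable {X : Type*} [MeasureSpace X] [TopologicalSpace X] {T : Set ((X → ℝ) × (X → ℝ))}

/-- The test space as a submodule. -/
def toSubmodule (hT : IsTestSpace T) : Submodule ℝ ((X → ℝ) × (X → ℝ)) where
  carrier := T
  zero_mem' := hT.zero_mem
  add_mem' := hT.add_mem
  smul_mem' c _ := hT.smul_mem c

lemma continuous_snd (hT : IsTestSpace T) {p} (hp : p ∈ T) : Continuous p.2 :=
  (hT.exists_deriv_mem hp).elim fun _ hr => hT.continuous_fst hr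

lemma hasCompactSupport_snd (hT : IsTestSpace T) {p} (hp : p ∈ T) : HasCompactSupport p.2 :=
  (hT.exists_deriv_mem hp).elim fun _ hr => hT.hasCompactSupport_fst hr

lemma exists_bound (hT : IsTestSpace T) {p} (hp : p ∈ T) : ∃ M : ℝ, 0 < M ∧ ∀ x, |p.1 x| ≤ M := by
  obtain ⟨M, hM⟩ := (hT.continuous_fst hp).bounded_above_of_compact_support
    (hT.hasCompactSupport_fst hp)
  exact ⟨max M 1, by positivity, fun x => (hM x).trans (le_max_left _ _)⟩

/-- The test function `φ g(ψ)`. -/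
noncomputable def mulComp {hT : IsTestSpace T} (p q : hT.toSubmodule) (g : ℝ → ℝ) (hg : ContDiff ℝ ∞ g) :
    hT.toSubmodule :=
  ⟨_, hT.mul_comp_mem g p.2 q.2 hg⟩

variable [BorelSpace X]

lemma integrable_fst (hT : IsTestSpace T) {μ : Measure X} [IsFiniteMeasure μ] {p} (hp : p ∈ T) : Integrable p.1 μ :=
  (hT.continuous_fst hp).integrable_of_hasCompactSupport (hT.hasCompactSupport_fst hp)

variable [IsFiniteMeasureOnCompacts (volume : Measure X)]

lemma memLp_snd (hT : IsTestSpace T) {p} (hp : p ∈ T) : MemLp p.2 2 (volume : Measure X) :=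
  (hT.continuous_snd hp).memLp_of_hasCompactSupport (hT.hasCompactSupport_snd hp)

/-- The map `φ ↦ φ'` from test functions to `L²`. -/
noncomputable def derivLp (hT : IsTestSpace T) : hT.toSubmodule →ₗ[ℝ] Lp ℝ 2 (volume : Measure X) where
  toFun p := (hT.memLp_snd p.2).toLp
  map_add' _ _ := MemLp.toLp_add _ _
  map_smul' _ _ := MemLp.toLp_const_smul _ _

lemma coeFn_derivLp (hT : IsTestSpace T) (p : hT.toSubmodule) : hT.derivLp p =ᵐ[volume] p.1.2 :=
  MemLp.coeFn_toLp (hT.memLp_snd p.2)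

lemma inner_derivLp (hT : IsTestSpace T) (u : Lp ℝ 2 (volume : Measure X)) (p : hT.toSubmodule) :
    inner ℝ u (hT.derivLp p) = ∫ x, u x * p.1.2 x := by
  rw [L2.inner_def]
  refine integral_congr_ae ?_
  filter_upwards [hT.coeFn_derivLp p] with x hx
  simp [hx, mul_comm]

lemma inner_derivLp_derivLp (hT : IsTestSpace T) (p q : hT.toSubmodule) :
    inner ℝ (hT.derivLp p) (hT.derivLp q) = ∫ x, p.1.2 x * q.1.2 x := by
  rw [inner_derivLp]
  refine integral_congr_ae ?_
  filter_upwards [hT.coeFn_derivLp p] with x hx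
  simp [hx]

/-- The derivatives of the test functions bounded by `1`. -/
def unitDerivs (hT : IsTestSpace T) : Set (Lp ℝ 2 (volume : Measure X)) :=
  {q | ∃ p : hT.toSubmodule, (∀ x, |p.1.1 x| ≤ 1) ∧ hT.derivLp p = q}

lemma zero_mem_unitDerivs (hT : IsTestSpace T) : 0 ∈ hT.unitDerivs := ⟨0, by simp, by simp⟩

lemma neg_mem_unitDerivs (hT : IsTestSpace T) {q} (hq : q ∈ hT.unitDerivs) : -q ∈ hT.unitDerivs := by
  obtain ⟨p, hp, rfl⟩ := hq
  exact ⟨-p, by simpa using hp, by simp⟩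

lemma convex_unitDerivs (hT : IsTestSpace T) : Convex ℝ hT.unitDerivs := by
  rintro _ ⟨p, hp, rfl⟩ _ ⟨q, hq, rfl⟩ a b ha hb hab
  refine ⟨a • p + b • q, fun x => ?_, by simp⟩
  have h1 := abs_le.1 (hp x)
  have h2 := abs_le.1 (hq x)
  simp only [Submodule.coe_add, Submodule.coe_smul, Prod.fst_add, Prod.smul_fst, Pi.add_apply,
    Pi.smul_apply, smul_eq_mul]
  rw [abs_le]
  constructor <;> nlinarith

/-- The functions `w` whose distributional derivative is bounded by `μ`: `|∫ w φ'| ≤ ∫ |φ| dμ`. -/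
def derivBoundedBy (hT : IsTestSpace T) (μ : Measure X) : Set (Lp ℝ 2 (volume : Measure X)) :=
  {w | ∀ p : hT.toSubmodule, inner ℝ w (hT.derivLp p) ≤ ∫ x, |p.1.1 x| ∂μ}

lemma neg_mem_derivBoundedBy (hT : IsTestSpace T) {μ : Measure X} {w} (hw : w ∈ hT.derivBoundedBy μ) :
    -w ∈ hT.derivBoundedBy μ := fun p => by
  simpa using hw (-p)

lemma convex_derivBoundedBy (hT : IsTestSpace T) (μ : Measure X) : Convex ℝ (hT.derivBoundedBy μ) := by
  intro v hv w hw a b ha hb hab p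
  rw [inner_add_left, real_inner_smul_left, real_inner_smul_left]
  calc _ ≤ a * (∫ x, |p.1.1 x| ∂μ) + b * ∫ x, |p.1.1 x| ∂μ := by gcongr <;> [exact hv p; exact hw p]
    _ = _ := by rw [← add_mul, hab, one_mul]

lemma isClosed_derivBoundedBy (hT : IsTestSpace T) (μ : Measure X) : IsClosed (hT.derivBoundedBy μ) := by
  simp only [derivBoundedBy, ofPred_forall]
  exact isClosed_iInter fun p => isClosed_le (by fun_prop) continuous_const

/-- It is enough to bound the derivative on nonnegative test functions. -/
lemma mem_derivBoundedBy_of_nonneg (hT : IsTestSpace T) {μ : Measure X} [IsFiniteMeasure μ]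
    {w : Lp ℝ 2 (volume : Measure X)}
    (hw : ∀ p : hT.toSubmodule, (∀ x, 0 ≤ p.1.1 x) →
      |inner ℝ w (hT.derivLp p)| ≤ ∫ x, p.1.1 x ∂μ) :
    w ∈ hT.derivBoundedBy μ := by
  intro p
  obtain ⟨q, hqT, hq0, hq1, hqp⟩ := hT.exists_cutoff p.2
  have key : ∀ δ : ℝ, 0 < δ →
      inner ℝ w (hT.derivLp p) ≤ (∫ x, |p.1.1 x| ∂μ) + δ * μ.real univ := by
    intro δ hδ
    have hg : ContDiff ℝ ∞ fun y : ℝ => √(y ^ 2 + δ ^ 2) :=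
      ContDiff.sqrt (by fun_prop) fun y => by positivity
    -- `√(p² + δ²)` is a smooth majorant of `|p|` but equals `δ` where `p = 0`; the cutoff `q`
    -- restores compact support. Then `p = (r + p)/2 - (r - p)/2` is a difference of nonnegative
    -- test functions whose sum is `r`.
    set r := mulComp (⟨q, hqT⟩ : hT.toSubmodule) p _ hg with hr
    have hrx : ∀ x, r.1.1 x = q.1 x * √(p.1.1 x ^ 2 + δ ^ 2) := fun x => rfl
    have hlow : ∀ x, |p.1.1 x| ≤ r.1.1 x := fun x => by
      by_cases hx : p.1.1 x = 0
      · rw [hx, abs_zero, hrx]; exact mul_nonneg (hq0 x) (Real.sqrt_nonneg _)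
      · rw [hrx, hqp x hx, one_mul]
        exact Real.abs_le_sqrt (by nlinarith [sq_nonneg δ])
    have hupp : ∀ x, r.1.1 x ≤ |p.1.1 x| + δ := fun x => by
      rw [hrx]
      have : √(p.1.1 x ^ 2 + δ ^ 2) ≤ |p.1.1 x| + δ := by
        refine Real.sqrt_le_iff.2 ⟨by positivity, ?_⟩
        nlinarith [sq_abs (p.1.1 x), abs_nonneg (p.1.1 x)]
      nlinarith [Real.sqrt_nonneg (p.1.1 x ^ 2 + δ ^ 2), hq0 x, hq1 x]
    have ha := hw ((1 / 2 : ℝ) • (r + p)) fun x => by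
      have : 0 ≤ (1 / 2) * (r.1.1 x + p.1.1 x) := by linarith [neg_abs_le (p.1.1 x), hlow x]
      simpa [mul_add] using this
    have hb := hw ((1 / 2 : ℝ) • (r - p)) fun x => by
      have : 0 ≤ (1 / 2) * (r.1.1 x - p.1.1 x) := by linarith [le_abs_self (p.1.1 x), hlow x]
      simpa [mul_sub] using this
    have hir : Integrable r.1.1 μ := hT.integrable_fst r.2
    have hip : Integrable p.1.1 μ := hT.integrable_fst p.2
    have hsum : (∫ x, ((1 / 2 : ℝ) • (r + p)).1.1 x ∂μ) + ∫ x, ((1 / 2 : ℝ) • (r - p)).1.1 x ∂μ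
        = ∫ x, r.1.1 x ∂μ := by
      rw [← integral_add]
      · refine integral_congr_ae (Eventually.of_forall fun x => ?_)
        simp; ring
      · exact hT.integrable_fst (Subtype.property _)
      · exact hT.integrable_fst (Subtype.property _)
    have hle : ∫ x, r.1.1 x ∂μ ≤ (∫ x, |p.1.1 x| ∂μ) + δ * μ.real univ := by
      calc _ ≤ ∫ x, (|p.1.1 x| + δ) ∂μ :=
            integral_mono hir (hip.abs.add (integrable_const _)) hupp
        _ = _ := by
            rw [integral_add hip.abs (integrable_const _), integral_const, smul_eq_mul, mul_comm δ]
    have e : inner ℝ w (hT.derivLp p) = inner ℝ w (hT.derivLp ((1 / 2 : ℝ) • (r + p)))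
        - inner ℝ w (hT.derivLp ((1 / 2 : ℝ) • (r - p))) := by
      simp only [map_smul, map_add, map_sub, inner_smul_right, inner_add_right, inner_sub_right]
      ring
    rw [e]
    linarith [(abs_le.1 ha).2, (abs_le.1 hb).1]
  refine ge_of_tendsto (x := 𝓝[>] (0 : ℝ)) (f := fun δ => (∫ x, |p.1.1 x| ∂μ) + δ * μ.real univ) ?_
    (eventually_nhdsWithin_of_forall key)
  refine Tendsto.mono_left ?_ nhdsWithin_le_nhds
  exact (Continuous.tendsto' (by fun_prop) _ _ (by simp))

end IsTestSpace
end TVFlow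

/-! ### Invariance of the derivative bound under the resolvent. -/

namespace TVFlow.IsTestSpace

variable {X : Type*} [MeasureSpace X] [TopologicalSpace X] {T : Set ((X → ℝ) × (X → ℝ))}
  [BorelSpace X] [IsFiniteMeasureOnCompacts (volume : Measure X)]

/-- `y ↦ ((1 + y) / 2) ^ (k + 1)`, a smooth approximation of the indicator of `1` on `[-1, 1]`. -/
noncomputable def peak (k : ℕ) (y : ℝ) : ℝ := ((1 + y) / 2) ^ (k + 1)

lemma contDiff_peak (k : ℕ) : ContDiff ℝ ∞ (peak k) := by
  unfold peak; fun_prop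

lemma hasDerivAt_peak (k : ℕ) (y : ℝ) :
    HasDerivAt (peak k) ((k + 1) / 2 * ((1 + y) / 2) ^ k) y := by
  have h : HasDerivAt (fun y : ℝ => (1 + y) / 2) (1 / 2) y :=
    ((hasDerivAt_id y).const_add 1).div_const 2
  refine (h.pow (k + 1)).congr_deriv ?_
  push_cast [Nat.add_sub_cancel]
  ring

lemma peak_nonneg (k : ℕ) {y : ℝ} (hy : |y| ≤ 1) : 0 ≤ peak k y :=
  pow_nonneg (by linarith [(abs_le.1 hy).1]) _

lemma peak_le_one (k : ℕ) {y : ℝ} (hy : |y| ≤ 1) : peak k y ≤ 1 :=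
  pow_le_one₀ (by linarith [(abs_le.1 hy).1]) (by linarith [(abs_le.1 hy).2])

/-- Bernoulli's inequality. It allows a small multiple of `φ (1 - peak k (ψ))` to be added to `ψ`
without exceeding `1`. -/
lemma one_sub_peak_le (k : ℕ) {y : ℝ} (hy : |y| ≤ 1) : 1 - peak k y ≤ (k + 1) * (1 - y) := by
  obtain ⟨h1, h2⟩ := abs_le.1 hy
  have := one_add_mul_le_pow (a := (y - 1) / 2) (by linarith) (k + 1)
  have e : peak k y = (1 + (y - 1) / 2) ^ (k + 1) := by unfold peak; congr 1; ring
  rw [e]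
  push_cast at this
  nlinarith [mul_nonneg (by positivity : (0 : ℝ) ≤ k + 1) (sub_nonneg.2 h2)]

lemma deriv_peak_nonneg (k : ℕ) {y : ℝ} (hy : |y| ≤ 1) : 0 ≤ deriv (peak k) y := by
  rw [(hasDerivAt_peak k y).deriv]
  have : 0 ≤ (1 + y) / 2 := by linarith [(abs_le.1 hy).1]
  positivity

lemma deriv_peak_le (k : ℕ) {y : ℝ} (hy : |y| ≤ 1) : deriv (peak k) y ≤ k + 1 := by
  rw [(hasDerivAt_peak k y).deriv]
  have : ((1 + y) / 2) ^ k ≤ 1 :=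
    pow_le_one₀ (by linarith [(abs_le.1 hy).1]) (by linarith [(abs_le.1 hy).2])
  nlinarith [(Nat.cast_nonneg k : (0 : ℝ) ≤ k)]

/-- The maximality of `p` controls the part of `φ` away from the contact set `{ψ = 1}`. -/
lemma inner_derivLp_le_mulComp_peak (hT : IsTestSpace T) {u p : Lp ℝ 2 (volume : Measure X)}
    (hmax : ∀ q ∈ hT.unitDerivs, inner ℝ u q ≤ inner ℝ u p) {φ ψ : hT.toSubmodule} {M : ℝ}
    (hM : 0 < M) (hφ0 : ∀ x, 0 ≤ φ.1.1 x) (hφM : ∀ x, φ.1.1 x ≤ M) (hψ : ∀ x, |ψ.1.1 x| ≤ 1)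
    (k : ℕ) :
    inner ℝ u (hT.derivLp φ) ≤ inner ℝ u (hT.derivLp (mulComp φ ψ (peak k) (contDiff_peak k)))
      + (k + 1) * M * inner ℝ u (p - hT.derivLp ψ) := by
  set χ := mulComp φ ψ (peak k) (contDiff_peak k) with hχ
  have hχx : ∀ x, χ.1.1 x = φ.1.1 x * peak k (ψ.1.1 x) := fun x => rfl
  have hk : (0 : ℝ) < (k + 1) * M := by positivity
  -- Competitor for the maximality: `ψ` is pushed up only away from `{ψ = 1}`, by at most `1 - ψ`.
  have h := hmax _ ⟨ψ + ((k + 1) * M)⁻¹ • (φ - χ), fun x => ?_, rfl⟩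
  · simp only [map_add, map_smul, map_sub, inner_add_right, inner_smul_right, inner_sub_right] at h ⊢
    have h2 : ((k + 1) * M)⁻¹ * (inner ℝ u (hT.derivLp φ) - inner ℝ u (hT.derivLp χ))
      ≤ inner ℝ u p - inner ℝ u (hT.derivLp ψ) := by linarith
    rw [inv_mul_le_iff₀ hk] at h2
    linarith
  · simp only [Submodule.coe_add, Submodule.coe_smul, Submodule.coe_sub, Prod.fst_add,
      Prod.smul_fst, Prod.fst_sub, Pi.add_apply, Pi.smul_apply, Pi.sub_apply, smul_eq_mul, hχx]
    have h1 := peak_le_one k (hψ x)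
    have h2 := one_sub_peak_le k (hψ x)
    obtain ⟨h3, h4⟩ := abs_le.1 (hψ x)
    have h5 : 0 ≤ ((k + 1) * M)⁻¹ * (φ.1.1 x - φ.1.1 x * peak k (ψ.1.1 x)) :=
      mul_nonneg (by positivity) (by nlinarith [hφ0 x])
    have h6 : ((k + 1) * M)⁻¹ * (φ.1.1 x - φ.1.1 x * peak k (ψ.1.1 x)) ≤ 1 - ψ.1.1 x := by
      rw [inv_mul_le_iff₀ hk]
      calc _ = φ.1.1 x * (1 - peak k (ψ.1.1 x)) := by ring
        _ ≤ M * ((k + 1) * (1 - ψ.1.1 x)) :=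
          mul_le_mul (hφM x) h2 (by linarith) hM.le
        _ = _ := by ring
    rw [abs_le]; constructor <;> linarith

/-- Weak form of `ψ'' ≤ 0` on `{ψ = 1}`, with an `O(1/k)` error. Expanding the product, the term `φ
(peak k)'(ψ) ψ'²` is nonnegative, and the rest is `φ' (G ∘ ψ)'` with `G' = peak k`, whose integral
is `-∫ φ'' G(ψ)`; here `r = φ''` and `0 ≤ G(ψ) ≤ 2/(k+2)`. -/
lemma neg_le_inner_derivLp_mulComp_peak (hT : IsTestSpace T) {φ ψ : hT.toSubmodule}
    {r : X → ℝ} (hr : (φ.1.2, r) ∈ T)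
    (hφ0 : ∀ x, 0 ≤ φ.1.1 x) (hψ : ∀ x, |ψ.1.1 x| ≤ 1) (k : ℕ) :
    -(2 / (k + 2) * ∫ x, |r x|) ≤
      inner ℝ (hT.derivLp ψ) (hT.derivLp (mulComp φ ψ (peak k) (contDiff_peak k))) := by
  have hG : ContDiff ℝ ∞ fun y : ℝ => 2 / ((k : ℝ) + 2) * peak (k + 1) y :=
    contDiff_const.mul (contDiff_peak _)
  have hG' : ∀ y : ℝ, deriv (fun y : ℝ => 2 / ((k : ℝ) + 2) * peak (k + 1) y) y = peak k y := by
    intro y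
    rw [((hasDerivAt_peak (k + 1) y).const_mul _).deriv, peak]
    push_cast
    field_simp
    ring
  set φ' : hT.toSubmodule := ⟨_, hr⟩
  have hint := hT.integral_deriv (mulComp φ' ψ _ hG).2
  have hval : ∀ x, (mulComp φ' ψ _ hG).1.2 x =
      r x * (2 / ((k : ℝ) + 2) * peak (k + 1) (ψ.1.1 x)) +
        φ.1.2 x * (peak k (ψ.1.1 x) * ψ.1.2 x) := fun x => by
    rw [← hG']; rfl
  have hI : Integrable (mulComp φ' ψ _ hG).1.2 (volume : Measure X) :=
    (hT.continuous_snd (Subtype.property _)).integrable_of_hasCompactSupport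
      (hT.hasCompactSupport_snd (Subtype.property _))
  have hrI : Integrable r (volume : Measure X) :=
    (hT.continuous_snd hr).integrable_of_hasCompactSupport (hT.hasCompactSupport_snd hr)
  rw [inner_derivLp_derivLp]
  have hI2 := ((hT.memLp_snd ψ.2).integrable_mul
    (hT.memLp_snd (mulComp φ ψ (peak k) (contDiff_peak k)).2))
  calc -(2 / (k + 2) * ∫ x, |r x|)
      = ∫ x, ((mulComp φ' ψ _ hG).1.2 x - 2 / (k + 2) * |r x|) := by
        rw [integral_sub hI (hrI.abs.const_mul _), integral_const_mul, hint, zero_sub]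
    _ ≤ _ := by
        refine integral_mono (hI.sub (hrI.abs.const_mul _)) hI2 fun x => ?_
        have e : ψ.1.2 x * (mulComp φ ψ (peak k) (contDiff_peak k)).1.2 x =
          ψ.1.2 x * (φ.1.2 x * peak k (ψ.1.1 x) +
            φ.1.1 x * (deriv (peak k) (ψ.1.1 x) * ψ.1.2 x)) := rfl
        change _ ≤ ψ.1.2 x * _
        rw [e, hval]
        have h1 : 0 ≤ φ.1.1 x * deriv (peak k) (ψ.1.1 x) * ψ.1.2 x ^ 2 :=
          mul_nonneg (mul_nonneg (hφ0 x) (deriv_peak_nonneg k (hψ x))) (sq_nonneg _)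
        have h2 : r x * (2 / ((k : ℝ) + 2) * peak (k + 1) (ψ.1.1 x)) ≤ 2 / (k + 2) * |r x| := by
          have h3 : r x * peak (k + 1) (ψ.1.1 x) ≤ |r x| := by
            nlinarith [le_abs_self (r x), peak_nonneg (k + 1) (hψ x), peak_le_one (k + 1) (hψ x),
              abs_nonneg (r x)]
          have h4 : (0 : ℝ) ≤ 2 / (k + 2) := by positivity
          nlinarith
        nlinarith

/-- For fixed `k` this stays bounded along a convergent sequence of `ψ'`, so that `p` may be
replaced by its approximations. -/
lemma norm_derivLp_mulComp_peak_le (hT : IsTestSpace T) {φ ψ : hT.toSubmodule} {M : ℝ}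
    (hφ0 : ∀ x, 0 ≤ φ.1.1 x) (hφM : ∀ x, φ.1.1 x ≤ M) (hψ : ∀ x, |ψ.1.1 x| ≤ 1) (k : ℕ) :
    ‖hT.derivLp (mulComp φ ψ (peak k) (contDiff_peak k))‖ ≤
      ‖hT.derivLp φ‖ + M * (k + 1) * ‖hT.derivLp ψ‖ := by
  have h : ‖hT.derivLp (mulComp φ ψ (peak k) (contDiff_peak k))‖ ≤
      ‖|hT.derivLp φ| + (M * (k + 1)) • |hT.derivLp ψ|‖ := by
    refine Lp.norm_le_norm_of_ae_le ?_
    filter_upwards [hT.coeFn_derivLp (mulComp φ ψ (peak k) (contDiff_peak k)), hT.coeFn_derivLp φ,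
      hT.coeFn_derivLp ψ, Lp.coeFn_add |hT.derivLp φ| ((M * (k + 1)) • |hT.derivLp ψ|),
      Lp.coeFn_smul (M * (k + 1)) |hT.derivLp ψ|, Lp.coeFn_abs (hT.derivLp φ),
      Lp.coeFn_abs (hT.derivLp ψ)] with x h1 h2 h3 h4 h5 h6 h7
    rw [h1, h4, Pi.add_apply, h5, Pi.smul_apply, h6, h7, h2, h3, smul_eq_mul]
    have hM : 0 ≤ M := (hφ0 x).trans (hφM x)
    refine le_trans ?_ (le_abs_self _)
    have e : (mulComp φ ψ (peak k) (contDiff_peak k)).1.2 x = φ.1.2 x * peak k (ψ.1.1 x) +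
            φ.1.1 x * (deriv (peak k) (ψ.1.1 x) * ψ.1.2 x) := rfl
    rw [e, Real.norm_eq_abs]
    refine (abs_add_le _ _).trans (add_le_add ?_ ?_)
    · rw [abs_mul, abs_of_nonneg (peak_nonneg k (hψ x))]
      exact mul_le_of_le_one_right (abs_nonneg _) (peak_le_one k (hψ x))
    · rw [abs_mul, abs_mul, abs_of_nonneg (hφ0 x), abs_of_nonneg (deriv_peak_nonneg k (hψ x)),
        ← mul_assoc]
      gcongr
      exacts [deriv_peak_nonneg k (hψ x), hφM x, deriv_peak_le k (hψ x)]
  refine h.trans ((norm_add_le _ _).trans ?_)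
  rw [norm_abs_eq_norm]
  rcases isEmpty_or_nonempty X with hX | ⟨⟨x⟩⟩
  · have : hT.derivLp ψ = 0 := Lp.ext (by
      filter_upwards with x; exact hX.elim x)
    simp [this]
  have hM : 0 ≤ M := (hφ0 x).trans (hφM x)
  rw [norm_smul, norm_abs_eq_norm, Real.norm_of_nonneg (by positivity)]

/-- One implicit time step does not increase the derivative: the upper bound on nonnegative test
functions. -/
lemma inner_derivLp_le_of_resolvent (hT : IsTestSpace T) {μ : Measure X} [IsFiniteMeasure μ]
    {f u p : Lp ℝ 2 (volume : Measure X)} {l : ℝ} (hl : 0 ≤ l) (hu : u = f - l • p)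
    (hp : p ∈ closure hT.unitDerivs) (hmax : ∀ q ∈ hT.unitDerivs, inner ℝ u q ≤ inner ℝ u p)
    (hf : f ∈ hT.derivBoundedBy μ) (φ : hT.toSubmodule) (hφ0 : ∀ x, 0 ≤ φ.1.1 x) :
    inner ℝ u (hT.derivLp φ) ≤ ∫ x, φ.1.1 x ∂μ := by
  obtain ⟨M, hM, hφM'⟩ := hT.exists_bound φ.2
  have hφM : ∀ x, φ.1.1 x ≤ M := fun x => (le_abs_self _).trans (hφM' x)
  obtain ⟨r, hr⟩ := hT.exists_deriv_mem φ.2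
  obtain ⟨q, hq, hqp⟩ := mem_closure_iff_seq_limit.1 hp
  choose ψ hψ hψq using hq
  -- The order of limits matters: the last bracket vanishes as `n → ∞` with `k` fixed, though its
  -- coefficients grow with `k`; only then `k → ∞`.
  have step : ∀ k n : ℕ, inner ℝ u (hT.derivLp φ) ≤ (∫ x, φ.1.1 x ∂μ)
      + l * (2 / (k + 2) * ∫ x, |r x|)
      + (l * (‖p - q n‖ * (‖hT.derivLp φ‖ + M * (k + 1) * ‖q n‖))
        + (k + 1) * M * inner ℝ u (p - q n)) := by
    intro k n
    have h1 := hT.inner_derivLp_le_mulComp_peak hmax hM hφ0 hφM (hψ n) k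
    have h2 := hT.neg_le_inner_derivLp_mulComp_peak hr hφ0 (hψ n) k
    have h3 := hT.norm_derivLp_mulComp_peak_le hφ0 hφM (hψ n) k
    have h4 := hf (mulComp φ (ψ n) (peak k) (contDiff_peak k))
    set χ := mulComp φ (ψ n) (peak k) (contDiff_peak k) with hχ
    rw [hψq] at h1 h2 h3
    have h5 : ∫ x, |χ.1.1 x| ∂μ ≤ ∫ x, φ.1.1 x ∂μ := by
      refine integral_mono (hT.integrable_fst χ.2).abs (hT.integrable_fst φ.2) fun x => ?_
      have e : χ.1.1 x = φ.1.1 x * peak k ((ψ n).1.1 x) := rfl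
      dsimp only
      rw [e, abs_mul, abs_of_nonneg (hφ0 x), abs_of_nonneg (peak_nonneg k (hψ n x))]
      exact mul_le_of_le_one_right (hφ0 x) (peak_le_one k (hψ n x))
    have h6 : inner ℝ u (hT.derivLp χ) = inner ℝ f (hT.derivLp χ)
        - l * (inner ℝ (q n) (hT.derivLp χ) + inner ℝ (p - q n) (hT.derivLp χ)) := by
      rw [hu, inner_sub_left, real_inner_smul_left, inner_sub_left]; ring
    have h7 : -(‖p - q n‖ * (‖hT.derivLp φ‖ + M * (k + 1) * ‖q n‖)) ≤
        inner ℝ (p - q n) (hT.derivLp χ) := by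
      refine (neg_le_neg ?_).trans (abs_le.1 (abs_real_inner_le_norm _ _)).1
      gcongr
    nlinarith [mul_le_mul_of_nonneg_left (add_le_add h2 h7) hl]
  have step2 : ∀ k : ℕ, inner ℝ u (hT.derivLp φ) ≤ (∫ x, φ.1.1 x ∂μ)
      + l * (2 / (k + 2) * ∫ x, |r x|) := by
    intro k
    refine ge_of_tendsto' (x := atTop) ?_ (step k)
    have hc : Continuous fun y : Lp ℝ 2 (volume : Measure X) => (∫ x, φ.1.1 x ∂μ)
      + l * (2 / (k + 2) * ∫ x, |r x|)
      + (l * (‖p - y‖ * (‖hT.derivLp φ‖ + M * (k + 1) * ‖y‖))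
        + (k + 1) * M * inner ℝ u (p - y)) := by fun_prop
    exact (hc.tendsto' p _ (by simp)).comp hqp
  refine ge_of_tendsto' (x := atTop) ?_ step2
  have h0 : Tendsto (fun k : ℕ => 2 / ((k : ℝ) + 2)) atTop (𝓝 0) :=
    Tendsto.const_div_atTop
      (tendsto_atTop_add_const_right _ _ tendsto_natCast_atTop_atTop) _
  simpa using ((h0.mul_const (∫ x, |r x|)).const_mul l).const_add (∫ x, φ.1.1 x ∂μ)

/-- One implicit time step does not increase the derivative. -/
lemma mem_derivBoundedBy_of_resolvent (hT : IsTestSpace T) {μ : Measure X} [IsFiniteMeasure μ]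
    {f u p : Lp ℝ 2 (volume : Measure X)} {l : ℝ} (hl : 0 ≤ l) (hu : u = f - l • p)
    (hp : p ∈ closure hT.unitDerivs) (hmax : ∀ q ∈ hT.unitDerivs, inner ℝ u q ≤ inner ℝ u p)
    (hf : f ∈ hT.derivBoundedBy μ) : u ∈ hT.derivBoundedBy μ := by
  refine hT.mem_derivBoundedBy_of_nonneg fun φ hφ0 => abs_le'.2 ⟨?_, ?_⟩
  · exact hT.inner_derivLp_le_of_resolvent hl hu hp hmax hf φ hφ0
  · rw [← inner_neg_left]
    refine hT.inner_derivLp_le_of_resolvent (f := -f) (p := -p) hl (by rw [hu, smul_neg]; abel) ?_ ?_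
      (hT.neg_mem_derivBoundedBy hf) φ hφ0
    · exact map_mem_closure continuous_neg hp fun q hq => hT.neg_mem_unitDerivs hq
    · intro q hq
      simpa using hmax _ (hT.neg_mem_unitDerivs hq)

end TVFlow.IsTestSpace

/-! ### Invariance of closed convex sets under gradient flows. -/

namespace TVFlow

/-- A function whose increments are bounded by `(t - s) (F t - F s)` does not increase. -/
lemma le_of_sub_le_mul_sub {D F : ℝ → ℝ} {a b : ℝ} (hab : a ≤ b)
    (h : ∀ s t, a ≤ s → s ≤ t → t ≤ b → D t - D s ≤ (t - s) * (F t - F s)) : D b ≤ D a := by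
  have key : ∀ n : ℕ, D b - D a ≤ (b - a) * (F b - F a) * (1 / ((n : ℝ) + 1)) := by
    intro n
    have hn : (0 : ℝ) < (n : ℝ) + 1 := by positivity
    -- Summed over `n + 1` equal steps, the increments of `F` telescope and the step length gives
    -- the factor `1/(n + 1)`.
    set τ : ℕ → ℝ := fun i => a + i * ((b - a) / (n + 1)) with hτ
    have hstep : 0 ≤ (b - a) / (n + 1) := div_nonneg (sub_nonneg.2 hab) hn.le
    have h0 : τ 0 = a := by simp [hτ]
    have h1 : τ (n + 1) = b := by simp only [hτ]; push_cast; field_simp; ring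
    have hmono : Monotone τ := fun i j hij => by
      simp only [hτ]; gcongr
    have hd : ∀ i, τ (i + 1) - τ i = (b - a) / (n + 1) := fun i => by
      simp only [hτ]; push_cast; ring
    have e1 : D b - D a = ∑ i ∈ Finset.range (n + 1), (D (τ (i + 1)) - D (τ i)) := by
      rw [Finset.sum_range_sub (fun i => D (τ i)), h0, h1]
    have e2 : F b - F a = ∑ i ∈ Finset.range (n + 1), (F (τ (i + 1)) - F (τ i)) := by
      rw [Finset.sum_range_sub (fun i => F (τ i)), h0, h1]
    calc D b - D a ≤ ∑ i ∈ Finset.range (n + 1), (b - a) / (n + 1) * (F (τ (i + 1)) - F (τ i)) := by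
          rw [e1]
          refine Finset.sum_le_sum fun i hi => ?_
          rw [← hd i]
          refine h _ _ (h0.symm.le.trans (hmono (Nat.zero_le _))) (hmono (Nat.le_succ _))
            ((hmono ?_).trans h1.le)
          have := Finset.mem_range.1 hi
          omega
      _ = _ := by rw [← Finset.mul_sum, ← e2]; ring
  have := ge_of_tendsto' (x := atTop)
    (tendsto_one_div_add_atTop_nhds_zero_nat.const_mul ((b - a) * (F b - F a))) key
  linarith

lemma sq_setIntegral_norm_le {V : Type*} [NormedAddCommGroup V] {v : ℝ → V} {s t : ℝ} (hst : s ≤ t)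
    (hv : MemLp v 2 (volume.restrict (Ioc s t))) :
    (∫ r in Ioc s t, ‖v r‖) ^ 2 ≤ (t - s) * ∫ r in Ioc s t, ‖v r‖ ^ 2 := by
  have hi1 : Integrable (fun r => ‖v r‖) (volume.restrict (Ioc s t)) :=
    (hv.integrable one_le_two).norm
  have hi2 : Integrable (fun r => ‖v r‖ ^ 2) (volume.restrict (Ioc s t)) :=
    hv.integrable_norm_pow two_ne_zero
  rcases hst.eq_or_lt with rfl | hlt
  · simp
  set I := ∫ r in Ioc s t, ‖v r‖ with hI
  have hpos : 0 < t - s := sub_pos.2 hlt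
  have h0 : 0 ≤ ∫ r in Ioc s t, (((t - s) ^ 2 * ‖v r‖ ^ 2 - 2 * I * (t - s) * ‖v r‖) + I ^ 2) :=
    integral_nonneg fun r => by
      have := sq_nonneg ((t - s) * ‖v r‖ - I)
      simp only [Pi.zero_apply]
      nlinarith
  have hi3 : Integrable (fun r => (t - s) ^ 2 * ‖v r‖ ^ 2 - 2 * I * (t - s) * ‖v r‖)
      (volume.restrict (Ioc s t)) := (hi2.const_mul _).sub (hi1.const_mul _)
  rw [integral_add hi3 (integrable_const _), integral_sub (hi2.const_mul _) (hi1.const_mul _), integral_const_mul, integral_const_mul,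
    ← hI, integral_const, smul_eq_mul] at h0
  simp only [measureReal_restrict_apply_univ, Real.volume_real_Ioc_of_le hst] at h0
  have : 0 ≤ (t - s) * ((t - s) * (∫ r in Ioc s t, ‖v r‖ ^ 2) - I ^ 2) := by nlinarith
  nlinarith [nonneg_of_mul_nonneg_right this hpos]

section Hilbert

variable {H : Type*} [NormedAddCommGroup H] [InnerProductSpace ℝ H]

/-- The map `w ↦ w - P w`, with `P` the projection onto a convex set, is `1`-Lipschitz. -/
lemma norm_sub_proj_sub_le {a b x y : H} (h1 : inner ℝ (a - x) (y - x) ≤ 0)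
    (h2 : inner ℝ (b - y) (x - y) ≤ 0) : ‖(a - x) - (b - y)‖ ≤ ‖a - b‖ := by
  have h3 : inner ℝ ((a - x) - (b - y)) ((a - x) - (b - y)) ≤
      inner ℝ ((a - x) - (b - y)) (a - b) := by
    have e : a - b = ((a - x) - (b - y)) + (x - y) := by abel
    have h4 : inner ℝ (a - x) (x - y) = -inner ℝ (a - x) (y - x) := by
      rw [← inner_neg_right, neg_sub]
    rw [e, inner_add_right _ _ (x - y), inner_sub_left _ _ (x - y), h4]
    linarith
  rw [real_inner_self_eq_norm_sq] at h3
  have h5 := h3.trans (real_inner_le_norm _ _)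
  by_contra! hc
  nlinarith [norm_nonneg (a - b)]

/-- The hypothesis gives `‖b - y‖ ≤ ‖b - x‖`, and `b - x = (a - x) + (b - a)` is expanded. It is a
one-sided first-order expansion of the squared distance, so nothing need be differentiated in time.
-/
lemma norm_sub_proj_sq_le {a b x y : H} (h2 : inner ℝ (b - y) (x - y) ≤ 0) :
    ‖b - y‖ ^ 2 ≤ ‖a - x‖ ^ 2 + 2 * inner ℝ (a - x) (b - a) + ‖b - a‖ ^ 2 := by
  have e1 : b - x = (a - x) + (b - a) := by abel
  have e2 : b - x = (b - y) - (x - y) := by abel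
  have h := norm_sub_sq_real (b - y) (x - y)
  rw [← norm_add_sq_real, ← e1, e2, h]
  nlinarith [sq_nonneg ‖x - y‖]

/-- A gradient flow starting in a closed convex set `K` remains there if the subgradients point
outwards at the complement of `K`. -/
theorem IsGradientFlow.mem_of_convex [CompleteSpace H] {E : H → EReal} {u₀ : H} {u : ℝ → H}
    (hu : IsGradientFlow E u₀ u) {K : Set H} (hK : Convex ℝ K) (hKc : IsClosed K) (h0 : u₀ ∈ K)
    (hE : ∀ w f x, f ∈ subdifferential E w → x ∈ K → (∀ y ∈ K, inner ℝ (w - x) (y - x) ≤ 0) →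
      0 ≤ inner ℝ (w - x) f) {t : ℝ} (ht : 0 ≤ t) : u t ∈ K := by
  have hproj : ∀ w : H, ∃ x ∈ K, ∀ y ∈ K, inner ℝ (w - x) (y - x) ≤ 0 := fun w => by
    obtain ⟨x, hx, hxe⟩ := exists_norm_eq_iInf_of_complete_convex ⟨u₀, h0⟩ hKc.isComplete hK w
    exact ⟨x, hx, (norm_eq_iInf_iff_real_inner_le_zero hK hx).1 hxe⟩
  choose P hPK hP using hproj
  obtain ⟨v, hvL, hvint, hvE⟩ := hu.exists_deriv
  have hlip : ∀ a b, ‖(a - P a) - (b - P b)‖ ≤ ‖a - b‖ := fun a b =>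
    norm_sub_proj_sub_le (hP a _ (hPK b)) (hP b _ (hPK a))
  have hcontR : Continuous fun w => w - P w :=
    LipschitzWith.continuous (K := 1) (LipschitzWith.of_dist_le_mul fun a b => by
      simpa [dist_eq_norm] using hlip a b)
  have hdec : ∀ a b, 0 < a → a ≤ b → ‖u b - P (u b)‖ ^ 2 ≤ ‖u a - P (u a)‖ ^ 2 := by
    intro a b ha hab
    have hvm : ∀ s t, a ≤ s → MemLp v 2 (volume.restrict (Ioc s t)) := fun s t hs =>
      (hvL (a / 2) (by linarith)).mono_measure
        (Measure.restrict_mono (fun r hr => lt_of_lt_of_le (by linarith) hr.1.le) le_rfl)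
    -- The constant `3` is `2 + 1`: twice the inner product term and once the squared increment,
    -- each bounded by `I ^ 2`.
    refine le_of_sub_le_mul_sub (D := fun t => ‖u t - P (u t)‖ ^ 2)
      (F := fun t => 3 * ∫ r in Ioc a t, ‖v r‖ ^ 2) hab ?_
    intro s t has hst htb
    have hm := hvm s t has
    have hvi : Integrable v (volume.restrict (Ioc s t)) := hm.integrable one_le_two
    set I := ∫ r in Ioc s t, ‖v r‖ with hI
    have hut : ∀ r ∈ Ioc s t, ‖u r - u s‖ ≤ I := by
      intro r hr
      rw [hvint s r (by linarith) hr.1.le, intervalIntegral.integral_of_le hr.1.le]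
      refine (norm_integral_le_integral_norm _).trans ?_
      exact setIntegral_mono_set hvi.norm (Eventually.of_forall fun _ => norm_nonneg _)
        (Ioc_subset_Ioc_right hr.2).eventuallyLE
    have hI0 : 0 ≤ I := integral_nonneg fun _ => norm_nonneg _
    have hnorm : ‖u t - u s‖ ≤ I := by
      rw [hvint s t (by linarith) hst, intervalIntegral.integral_of_le hst]
      exact norm_integral_le_integral_norm _
    have hinner : inner ℝ (u s - P (u s)) (u t - u s) ≤ I ^ 2 := by
      rw [hvint s t (by linarith) hst, intervalIntegral.integral_of_le hst, ← integral_inner hvi]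
      calc _ ≤ ∫ r in Ioc s t, I * ‖v r‖ := by
            refine integral_mono_ae (hvi.const_inner _) (hvi.norm.const_mul _) ?_
            have hsub : Ioc s t ⊆ Ioi 0 := fun r hr => lt_of_lt_of_le (by linarith) hr.1.le
            filter_upwards [ae_restrict_of_ae_restrict_of_subset hsub hvE,
              ae_restrict_mem measurableSet_Ioc] with r hr hrm
            have h1 := hE _ _ _ hr (hPK _) (hP _)
            rw [inner_neg_right] at h1
            -- The subgradient is known at time `r`, so the normal vector is moved from `s` to `r`,
            -- at a cost controlled by its Lipschitz bound.
            have e : u s - P (u s) = (u r - P (u r)) + ((u s - P (u s)) - (u r - P (u r))) := by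
              abel
            rw [e, inner_add_left]
            have h2 := real_inner_le_norm ((u s - P (u s)) - (u r - P (u r))) (v r)
            have h3 : ‖(u s - P (u s)) - (u r - P (u r))‖ ≤ I := by
              refine (hlip _ _).trans ?_
              rw [norm_sub_rev]; exact hut r hrm
            nlinarith [norm_nonneg (v r)]
        _ = I ^ 2 := by rw [integral_const_mul, ← hI]; ring
    have h4 := norm_sub_proj_sq_le (a := u s) (x := P (u s)) (hP (u t) _ (hPK (u s)))
    have h5 := sq_setIntegral_norm_le hst hm
    have h6 : (∫ r in Ioc a t, ‖v r‖ ^ 2) - ∫ r in Ioc a s, ‖v r‖ ^ 2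
        = ∫ r in Ioc s t, ‖v r‖ ^ 2 := by
      have hi : ∀ s' t', a ≤ s' → s' ≤ t' → IntervalIntegrable (fun r => ‖v r‖ ^ 2) volume s' t' :=
        fun s' t' h h' => (intervalIntegrable_iff_integrableOn_Ioc_of_le h').2
          ((hvm s' t' h).integrable_norm_pow two_ne_zero)
      rw [← intervalIntegral.integral_of_le (has.trans hst), ← intervalIntegral.integral_of_le has,
        ← intervalIntegral.integral_of_le hst, sub_eq_iff_eq_add', eq_comm]
      exact intervalIntegral.integral_add_adjacent_intervals (hi _ _ le_rfl has) (hi _ _ has hst)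
    rw [← mul_sub, h6]
    nlinarith [norm_nonneg (u t - u s)]
  have hzero : ‖u t - P (u t)‖ ^ 2 ≤ 0 := by
    rcases ht.eq_or_lt with rfl | htpos
    · have := hP u₀ u₀ h0
      rw [real_inner_self_eq_norm_sq] at this
      rwa [hu.initial]
    -- `v` is square integrable only away from time `0`; continuity of `u` carries the decay down to
    -- `0`.
    have hlim : Tendsto (fun a => ‖u a - P (u a)‖ ^ 2) (𝓝[>] 0) (𝓝 (‖u 0 - P (u 0)‖ ^ 2)) := by
      have h1 : Tendsto u (𝓝[>] 0) (𝓝 (u 0)) :=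
        (hu.continuousOn 0 self_mem_Ici).mono_left (nhdsWithin_mono _ Ioi_subset_Ici_self)
      exact ((hcontR.tendsto (u 0)).comp h1).norm.pow 2
    have h2 : ‖u 0 - P (u 0)‖ ^ 2 ≤ 0 := by
      have := hP u₀ u₀ h0
      rw [real_inner_self_eq_norm_sq] at this
      rwa [hu.initial]
    refine (ge_of_tendsto hlim ?_).trans h2
    filter_upwards [Ioc_mem_nhdsGT htpos] with a ha
    exact hdec a t ha.1 ha.2
  have : u t - P (u t) = 0 := by
    rw [← norm_eq_zero]
    exact pow_eq_zero_iff two_ne_zero |>.1 (le_antisymm hzero (sq_nonneg _))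
  rw [sub_eq_zero.1 this]
  exact hPK _

end Hilbert

/-! ### Subgradients of the total variation and the derivative bound. -/

namespace IsTestSpace

variable {X : Type*} [MeasureSpace X] [TopologicalSpace X] {T : Set ((X → ℝ) × (X → ℝ))}
  [BorelSpace X] [IsFiniteMeasureOnCompacts (volume : Measure X)]

/-- `TV` is the support function of `unitDerivs`; the minus sign in its definition is absorbed by `φ
↦ -φ`. -/
lemma inner_le_totalVariation (hT : IsTestSpace T) (w : Lp ℝ 2 (volume : Measure X)) {q}
    (hq : q ∈ hT.unitDerivs) : ((inner ℝ w q : ℝ) : EReal) ≤ totalVariation T w := by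
  obtain ⟨p, hp, rfl⟩ := hq
  refine le_trans (le_of_eq ?_) (le_iSup₂ (f := fun (p : (X → ℝ) × (X → ℝ))
    (_ : p ∈ {p ∈ T | ∀ x, |p.1 x| ≤ 1}) => ((-∫ x, w x * p.2 x : ℝ) : EReal)) (-p.1)
    ⟨(-p).2, by simpa using hp⟩)
  rw [hT.inner_derivLp]
  simp [integral_neg]

lemma totalVariation_le (hT : IsTestSpace T) {w : Lp ℝ 2 (volume : Measure X)} {c : ℝ}
    (hc : ∀ q ∈ hT.unitDerivs, inner ℝ w q ≤ c) : totalVariation T w ≤ c := by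
  refine iSup₂_le fun p hp => ?_
  rw [EReal.coe_le_coe_iff]
  have := hc _ (hT.neg_mem_unitDerivs ⟨⟨p, hp.1⟩, hp.2, rfl⟩)
  rwa [inner_neg_right, hT.inner_derivLp] at this

/-- The resolvent of the total variation exists; it is found through the dual problem. -/
lemma exists_resolvent (hT : IsTestSpace T) (f : Lp ℝ 2 (volume : Measure X)) {l : ℝ} (hl : 0 < l) :
    ∃ p ∈ closure hT.unitDerivs, ∀ q ∈ hT.unitDerivs,
      inner ℝ (f - l • p) q ≤ inner ℝ (f - l • p) p := by
  -- `p` is the point nearest to `f / l`; its variational inequality, scaled by `l`, is the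
  -- maximality.
  obtain ⟨p, hp, hpe⟩ := exists_norm_eq_iInf_of_complete_convex
    ⟨0, subset_closure hT.zero_mem_unitDerivs⟩ isClosed_closure.isComplete
    hT.convex_unitDerivs.closure (l⁻¹ • f)
  refine ⟨p, hp, fun q hq => ?_⟩
  have h := (norm_eq_iInf_iff_real_inner_le_zero hT.convex_unitDerivs.closure hp).1 hpe q
    (subset_closure hq)
  have e : f - l • p = l • (l⁻¹ • f - p) := by
    rw [smul_sub, smul_inv_smul₀ hl.ne']
  rw [e, real_inner_smul_left, real_inner_smul_left]
  rw [inner_sub_right] at h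
  nlinarith

lemma inner_le_of_mem_derivBoundedBy (hT : IsTestSpace T) {μ : Measure X} [IsFiniteMeasure μ]
    {w : Lp ℝ 2 (volume : Measure X)} (hw : w ∈ hT.derivBoundedBy μ) {q}
    (hq : q ∈ closure hT.unitDerivs) : inner ℝ w q ≤ μ.real univ := by
  refine closure_minimal (t := {q | inner ℝ w q ≤ μ.real univ}) ?_
    (isClosed_le (by fun_prop) continuous_const) hq
  rintro _ ⟨p, hp, rfl⟩
  refine (hw p).trans ?_
  calc ∫ x, |p.1.1 x| ∂μ ≤ ∫ x, 1 ∂μ :=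
        integral_mono (hT.integrable_fst p.2).abs (integrable_const _) hp
    _ = _ := by simp

/-- The subgradients of the total variation point outwards of `derivBoundedBy μ`. -/
lemma inner_subdifferential_nonneg (hT : IsTestSpace T) {μ : Measure X} [IsFiniteMeasure μ]
    {w f x : Lp ℝ 2 (volume : Measure X)} (hf : f ∈ subdifferential (totalVariation T) w)
    (hx : x ∈ hT.derivBoundedBy μ)
    (hxw : ∀ y ∈ hT.derivBoundedBy μ, inner ℝ (w - x) (y - x) ≤ 0) :
    0 ≤ inner ℝ (w - x) f := by
  have key : ∀ l : ℝ, 0 < l → -(√(l * μ.real univ) * ‖f‖) ≤ inner ℝ (w - x) f := by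
    intro l hl
    obtain ⟨p, hp, hmax⟩ := hT.exists_resolvent x hl
    set J := x - l • p with hJ
    have hJK : J ∈ hT.derivBoundedBy μ :=
      hT.mem_derivBoundedBy_of_resolvent hl.le hJ hp hmax hx
    have hmono : ∀ q ∈ hT.unitDerivs, inner ℝ w q + inner ℝ (J - w) f ≤ inner ℝ J p := by
      intro q hq
      -- The subgradient inequality at `w`, tested at `J`, where `TV J ≤ (J, p)` by maximality.
      have h1 := hf.2 (J - w)
      rw [add_sub_cancel] at h1
      have h2 := (add_le_add (hT.inner_le_totalVariation w hq) le_rfl).trans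
        (h1.trans (hT.totalVariation_le hmax))
      exact_mod_cast h2
    have hmono' : inner ℝ w p + inner ℝ (J - w) f ≤ inner ℝ J p :=
      closure_minimal (t := {q | inner ℝ w q + inner ℝ (J - w) f ≤ inner ℝ J p}) hmono
        (isClosed_le (by fun_prop) continuous_const) hp
    -- Since `J = x - l p` lies in `K`, it is admissible in the inequality characterising the
    -- projection `x`.
    have hpos : 0 ≤ inner ℝ (w - x) p := by
      have := hxw J hJK
      have e : J - x = -(l • p) := by rw [hJ]; abel
      rw [e, inner_neg_right, real_inner_smul_right] at this
      exact nonneg_of_mul_nonneg_right (by linarith) hl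
    have hJp : 0 ≤ inner ℝ J p := by simpa using hmax 0 hT.zero_mem_unitDerivs
    -- From `(J, p) ≥ 0`, `l ‖p‖² ≤ (x, p) ≤ μ(X)`; hence replacing `J` by `x` costs only `O(√l)`.
    have hsmall : ‖l • p‖ ≤ √(l * μ.real univ) := by
      refine Real.le_sqrt_of_sq_le ?_
      have h3 := hT.inner_le_of_mem_derivBoundedBy hx hp
      rw [hJ, inner_sub_left, real_inner_smul_left, real_inner_self_eq_norm_sq] at hJp
      rw [norm_smul, Real.norm_of_nonneg hl.le]
      nlinarith
    have h4 := (abs_le.1 (abs_real_inner_le_norm (l • p) f)).2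
    have h5 : ‖l • p‖ * ‖f‖ ≤ √(l * μ.real univ) * ‖f‖ := by gcongr
    have e1 : inner ℝ (w - x) f = -inner ℝ (J - w) f - inner ℝ (l • p) f := by
      rw [← inner_neg_left, ← inner_sub_left, hJ]; congr 1; abel
    have e2 : inner ℝ (w - x) p = inner ℝ w p - inner ℝ J p - l * ‖p‖ ^ 2 := by
      rw [← real_inner_self_eq_norm_sq, ← real_inner_smul_left, ← inner_sub_left, ← inner_sub_left,
        hJ]
      congr 1; abel
    nlinarith [mul_nonneg hl.le (sq_nonneg ‖p‖)]
  refine le_of_tendsto (x := 𝓝[>] (0 : ℝ)) ?_ (eventually_nhdsWithin_of_forall key)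
  refine Tendsto.mono_left ?_ nhdsWithin_le_nhds
  exact Continuous.tendsto' (by fun_prop) _ _ (by simp)

/-- The bound `|Du| ≤ μ` is preserved by the total variation flow. -/
theorem mem_derivBoundedBy_of_isTVFlow (hT : IsTestSpace T) {μ : Measure X} [IsFiniteMeasure μ]
    {u₀ : Lp ℝ 2 (volume : Measure X)} {u : ℝ → Lp ℝ 2 (volume : Measure X)}
    (hu : IsTVFlow T u₀ u) (h0 : u₀ ∈ hT.derivBoundedBy μ) {t : ℝ} (ht : 0 ≤ t) :
    u t ∈ hT.derivBoundedBy μ :=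
  IsGradientFlow.mem_of_convex hu (hT.convex_derivBoundedBy μ) (hT.isClosed_derivBoundedBy μ) h0
    (fun _ _ _ hf hx hxw => hT.inner_subdifferential_nonneg hf hx hxw) ht

end IsTestSpace

end TVFlow

open scoped NNReal CompactlySupported Pointwise

/-! ### Representation of bounded functionals by signed measures. -/

namespace TVFlow

/-- Hahn-Banach for a functional given on the domain of a linear map. -/
lemma exists_dual_comp_eq_of_le_seminorm {V E : Type*} [AddCommGroup V] [Module ℝ V]
    [AddCommGroup E] [Module ℝ E] (N : V →ₗ[ℝ] ℝ) (i : V →ₗ[ℝ] E) (p : Seminorm ℝ E)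
    (h : ∀ v, N v ≤ p (i v)) :
    ∃ g : E →ₗ[ℝ] ℝ, (∀ v, g (i v) = N v) ∧ ∀ x, |g x| ≤ p x := by
  obtain ⟨s, hs⟩ := i.rangeRestrict.exists_rightInverse_of_surjective i.range_rangeRestrict
  have hs' : ∀ x : i.range, i (s x) = x := fun x => congrArg Subtype.val (LinearMap.congr_fun hs x)
  obtain ⟨g, hg, hgp⟩ := Module.Dual.exists_extension_of_le_seminorm_real i.range (N ∘ₗ s) (p := p)
    fun x => by simpa [hs'] using h (s x)
  refine ⟨g, fun v => ?_, hgp⟩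
  have hv : g (i v) = N (s (i.rangeRestrict v)) := hg (i.rangeRestrict v)
  -- The bound, applied to a kernel element of `i` and its negative, makes `N` vanish there, so the
  -- choice of section is harmless.
  have h0 : i (s (i.rangeRestrict v) - v) = 0 := by rw [map_sub, hs']; simp
  have h1 := h (s (i.rangeRestrict v) - v)
  have h2 := h (-(s (i.rangeRestrict v) - v))
  rw [h0, map_zero, map_sub] at h1
  rw [map_neg, map_neg, h0, neg_zero, map_zero, map_sub] at h2
  linarith

section SignedIntegral

variable {X : Type*} [MeasurableSpace X] {μ ν : Measure X} [IsFiniteMeasure μ] [IsFiniteMeasure ν]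

lemma totalVariation_toSignedMeasure_sub_le :
    (μ.toSignedMeasure - ν.toSignedMeasure).totalVariation ≤ μ + ν := by
  rw [SignedMeasure.totalVariation, Measure.toJordanDecomposition_toSignedMeasure_sub]
  exact add_le_add Measure.sub_le Measure.sub_le

end SignedIntegral

section Density

variable {X : Type*} [MeasureSpace X] {μ ν : Measure X} [IsFiniteMeasure μ] [IsFiniteMeasure ν]

lemma signedIntegral_toSignedMeasure_sub {φ : X → ℝ} (hμ : Integrable φ μ) (hν : Integrable φ ν) :
    signedIntegral φ (μ.toSignedMeasure - ν.toSignedMeasure) =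
      (∫ x, φ x ∂μ) - ∫ x, φ x ∂ν := by
  -- Subtraction of measures is truncated: `μ - ν` and `ν - μ` are the two Jordan parts, and this
  -- identity links them to `μ` and `ν`.
  have h : μ + (ν - μ) = (μ - ν) + ν := by
    rw [← Measure.toSignedMeasure_eq_toSignedMeasure_iff, Measure.toSignedMeasure_add,
      Measure.toSignedMeasure_add, ← sub_eq_sub_iff_add_eq_add]
    exact Measure.sub_toSignedMeasure_eq_toSignedMeasure_sub
  have h1 : Integrable φ (μ - ν) := hμ.mono_measure Measure.sub_le
  have h2 : Integrable φ (ν - μ) := hν.mono_measure Measure.sub_le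
  have h3 := congrArg (fun m => ∫ x, φ x ∂m) h
  simp only [integral_add_measure hμ h2, integral_add_measure h1 hν] at h3
  rw [signedIntegral, Measure.toJordanDecomposition_toSignedMeasure_sub,
    Measure.jordanDecompositionOfToSignedMeasureSub_posPart,
    Measure.jordanDecompositionOfToSignedMeasureSub_negPart]
  linarith

/-- A functional on `L²(μ)` which is bounded by the `L¹` seminorm is given by a signed measure of
total variation at most `μ`. -/
lemma exists_signedMeasure_of_le_integral_abs (g : Lp ℝ 2 μ →ₗ[ℝ] ℝ)
    (hg : ∀ f, |g f| ≤ ∫ x, |f x| ∂μ) :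
    ∃ m : SignedMeasure X, m.totalVariation ≤ μ ∧
      ∀ (φ : X → ℝ) (hφ : MemLp φ 2 μ), signedIntegral φ m = g hφ.toLp := by
  have hbd : ∀ f : Lp ℝ 2 μ, ∫ x, |f x| ∂μ ≤ √(μ.real univ) * ‖f‖ := fun f => by
    have h1 : ∫ x, |f x| ∂μ = inner ℝ (indicatorConstLp 2 MeasurableSet.univ
        (measure_ne_top μ univ) (1 : ℝ)) |f| := by
      rw [L2.inner_indicatorConstLp_one, Measure.restrict_univ]
      exact integral_congr_ae ((Lp.coeFn_abs f).mono fun x hx => hx.symm)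
    rw [h1]
    refine (real_inner_le_norm _ _).trans ?_
    rw [norm_abs_eq_norm, norm_indicatorConstLp two_ne_zero ENNReal.ofNat_ne_top]
    simp [Real.sqrt_eq_rpow]
  set G : StrongDual ℝ (Lp ℝ 2 μ) := g.mkContinuous (√(μ.real univ)) fun f =>
    (hg f).trans (hbd f) with hG
  set h := (InnerProductSpace.toDual ℝ (Lp ℝ 2 μ)).symm G with hh
  have hin : ∀ f, inner ℝ h f = g f := fun f => by
    rw [hh, InnerProductSpace.toDual_symm_apply]; rfl
  -- Testing the `L¹` bound on indicators forces the Riesz density `h` to satisfy `|h| ≤ 1` almost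
  -- everywhere.
  have hset : ∀ s, MeasurableSet s → |∫ x in s, h x ∂μ| ≤ μ.real s := fun s hs => by
    rw [← L2.inner_indicatorConstLp_one (𝕜 := ℝ) hs (measure_ne_top μ s), real_inner_comm, hin]
    refine (hg _).trans_eq ?_
    rw [← integral_indicator_one hs]
    refine integral_congr_ae ?_
    filter_upwards [indicatorConstLp_coeFn (p := 2) (hs := hs) (hμs := measure_ne_top μ s)
      (c := (1 : ℝ))] with x hx
    rw [hx]
    by_cases hxs : x ∈ s <;> simp [hxs]
  have hint : Integrable h μ := (Lp.memLp h).integrable one_le_two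
  have hle1 : ∀ᵐ x ∂μ, h x ≤ 1 := by
    refine ae_le_of_forall_setIntegral_le hint (integrable_const 1) fun s hs _ => ?_
    simpa using (abs_le.1 (hset s hs)).2
  have hle2 : ∀ᵐ x ∂μ, -h x ≤ 1 := by
    refine ae_le_of_forall_setIntegral_le hint.neg (integrable_const 1) fun s hs _ => ?_
    simp only [integral_neg]
    simpa using neg_le.1 (abs_le.1 (hset s hs)).1
  have hmeas : Measurable h := (Lp.stronglyMeasurable h).measurable
  have hmeas' : Measurable fun x => -h x := hmeas.neg
  have := isFiniteMeasure_withDensity_ofReal hint.2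
  have := isFiniteMeasure_withDensity_ofReal (f := fun x => -h x) hint.neg.2
  set m₁ := μ.withDensity fun x => ENNReal.ofReal (h x) with hm₁
  set m₂ := μ.withDensity fun x => ENNReal.ofReal (-h x) with hm₂
  have hsum : m₁ + m₂ ≤ μ := by
    rw [hm₁, hm₂, ← withDensity_add_left hmeas.ennreal_ofReal]
    conv_rhs => rw [← withDensity_one (μ := μ)]
    refine withDensity_mono ?_
    filter_upwards [hle1, hle2] with x h1 h2
    simp only [Pi.add_apply, Pi.one_apply]
    rcases le_total 0 (h x) with h0 | h0
    · rw [ENNReal.ofReal_of_nonpos (neg_nonpos.2 h0), add_zero]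
      exact ENNReal.ofReal_le_one.2 h1
    · rw [ENNReal.ofReal_of_nonpos h0, zero_add]
      exact ENNReal.ofReal_le_one.2 h2
  refine ⟨m₁.toSignedMeasure - m₂.toSignedMeasure,
    totalVariation_toSignedMeasure_sub_le.trans hsum, fun φ hφ => ?_⟩
  have hφi := hφ.integrable one_le_two
  have hi1 : Integrable φ m₁ := hφi.mono_measure ((Measure.le_add_right le_rfl).trans hsum)
  have hi2 : Integrable φ m₂ := hφi.mono_measure ((Measure.le_add_left le_rfl).trans hsum)
  have hi1' := (integrable_withDensity_iff_integrable_smul' hmeas.ennreal_ofReal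
    (Eventually.of_forall fun _ => ENNReal.ofReal_lt_top)).1 hi1
  have hi2' := (integrable_withDensity_iff_integrable_smul' hmeas'.ennreal_ofReal
    (Eventually.of_forall fun _ => ENNReal.ofReal_lt_top)).1 hi2
  rw [signedIntegral_toSignedMeasure_sub hi1 hi2, ← hin, L2.inner_def, hm₁, hm₂,
    integral_withDensity_eq_integral_toReal_smul hmeas.ennreal_ofReal
      (Eventually.of_forall fun _ => ENNReal.ofReal_lt_top),
    integral_withDensity_eq_integral_toReal_smul hmeas'.ennreal_ofReal
      (Eventually.of_forall fun _ => ENNReal.ofReal_lt_top), ← integral_sub hi1' hi2']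
  refine integral_congr_ae ?_
  filter_upwards [hφ.coeFn_toLp] with x hx
  simp only [smul_eq_mul, ENNReal.toReal_ofReal', hx]
  rw [← sub_mul, max_zero_sub_max_neg_zero_eq_self]
  simp [mul_comm]

end Density

/-! ### Riesz-Markov representation for functionals bounded in the sup norm. -/

section Riesz

variable {X : Type*} [TopologicalSpace X]

/-- The sup norm on `C_c(X, ℝ)`, as a seminorm. -/
noncomputable def supSeminorm (X : Type*) [TopologicalSpace X] : Seminorm ℝ C_c(X, ℝ) :=
  (normSeminorm ℝ (BoundedContinuousFunction X ℝ)).comp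
    ({ toFun := CompactlySupportedContinuousMap.toBoundedContinuousFunction
       map_add' := fun _ _ => rfl
       map_smul' := fun _ _ => rfl } : C_c(X, ℝ) →ₗ[ℝ] BoundedContinuousFunction X ℝ)

lemma supSeminorm_le {f : C_c(X, ℝ)} {M : ℝ} (hM : 0 ≤ M) (h : ∀ x, |f x| ≤ M) :
    supSeminorm X f ≤ M :=
  (BoundedContinuousFunction.norm_le hM).2 h

lemma abs_le_supSeminorm (f : C_c(X, ℝ)) (x : X) : |f x| ≤ supSeminorm X f :=
  BoundedContinuousFunction.norm_coe_le_norm (f.toBoundedContinuousFunction) x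

/-- The values of a functional on the functions below `f`. -/
def valuesBelow (g : C_c(X, ℝ) →ₗ[ℝ] ℝ) (f : C_c(X, ℝ≥0)) : Set ℝ :=
  (fun ψ : C_c(X, ℝ≥0) => g ψ.toReal) '' Iic f

lemma zero_mem_valuesBelow (g : C_c(X, ℝ) →ₗ[ℝ] ℝ) (f : C_c(X, ℝ≥0)) :
    0 ∈ valuesBelow g f :=
  ⟨0, fun x => zero_le, by
    have : (0 : C_c(X, ℝ≥0)).toReal = 0 := by ext; simp
    simp [this]⟩

variable {g : C_c(X, ℝ) →ₗ[ℝ] ℝ} {c : ℝ}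

lemma le_of_mem_valuesBelow (hg : ∀ f, |g f| ≤ c * supSeminorm X f) (hc : 0 ≤ c)
    {f : C_c(X, ℝ≥0)} {M : ℝ} (hM : 0 ≤ M) (hf : ∀ x, (f x : ℝ) ≤ M) {y : ℝ}
    (hy : y ∈ valuesBelow g f) : y ≤ c * M := by
  obtain ⟨ψ, hψ, rfl⟩ := hy
  refine (le_abs_self _).trans ((hg _).trans ?_)
  gcongr
  refine supSeminorm_le hM fun x => ?_
  simp only [CompactlySupportedContinuousMap.toReal_apply, NNReal.abs_eq]
  exact (NNReal.coe_le_coe.2 (hψ x)).trans (hf x)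

lemma bddAbove_valuesBelow (hg : ∀ f, |g f| ≤ c * supSeminorm X f) (hc : 0 ≤ c)
    (f : C_c(X, ℝ≥0)) : BddAbove (valuesBelow g f) :=
  ⟨_, fun _ => le_of_mem_valuesBelow hg hc (apply_nonneg _ _) fun x => by
    simpa using abs_le_supSeminorm f.toReal x⟩

/-- The positive part of a bounded functional. -/
lemma exists_positivePart (hg : ∀ f, |g f| ≤ c * supSeminorm X f) (hc : 0 ≤ c) :
    ∃ L : C_c(X, ℝ) →ₚ[ℝ] ℝ, (∀ f, 0 ≤ f → g f ≤ L f) ∧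
      ∀ f, 0 ≤ f → (∀ x, f x ≤ 1) → L f ≤ c := by
  have hbdd := bddAbove_valuesBelow hg hc
  have hne : ∀ f, (valuesBelow g f).Nonempty := fun f => ⟨0, zero_mem_valuesBelow g f⟩
  have hsmul : ∀ (a : ℝ≥0) f, a * sSup (valuesBelow g f) ≤ sSup (valuesBelow g (a • f)) := by
    intro a f
    have h := Real.sSup_smul_of_nonneg a.coe_nonneg (valuesBelow g f)
    rw [smul_eq_mul] at h
    rw [← h]
    refine csSup_le (hne f).smul_set ?_
    rintro _ ⟨_, ⟨ψ, hψ, rfl⟩, rfl⟩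
    refine le_csSup (hbdd _) ⟨a • ψ, fun x => ?_, ?_⟩
    · exact mul_le_mul_right (hψ x) a
    · have : (a • ψ).toReal = (a : ℝ) • ψ.toReal := by ext; simp [NNReal.smul_def]
      simp [this]
  let Λ : C_c(X, ℝ≥0) →ₗ[ℝ≥0] ℝ≥0 :=
    { toFun := fun f => ⟨sSup (valuesBelow g f), le_csSup (hbdd f) (zero_mem_valuesBelow g f)⟩
      map_add' := fun f₁ f₂ => by
        refine NNReal.coe_injective (le_antisymm ?_ ?_)
        · refine csSup_le (hne _) ?_
          rintro _ ⟨ψ, hψ, rfl⟩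
          -- Riesz decomposition: `ψ ≤ f₁ + f₂` splits as `ψ ⊓ f₁` plus a remainder below `f₂`.
          obtain ⟨χ, hχ⟩ := CompactlySupportedContinuousMap.exists_add_of_le
            (inf_le_left : ψ ⊓ f₁ ≤ ψ)
          have hχ' : χ ≤ f₂ := fun x => by
            have h1 : (ψ ⊓ f₁) x + χ x = ψ x := DFunLike.congr_fun hχ x
            have h2 : ψ x ≤ f₁ x + f₂ x := hψ x
            rw [CompactlySupportedContinuousMap.inf_apply] at h1
            rcases le_total (ψ x) (f₁ x) with h | h
            · rw [inf_of_le_left h] at h1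
              rw [show χ x = 0 by simpa using h1]; exact zero_le
            · rw [inf_of_le_right h] at h1
              rw [← h1] at h2
              exact le_of_add_le_add_left h2
          dsimp only
          rw [← hχ, CompactlySupportedContinuousMap.toReal_add, map_add]
          exact add_le_add (le_csSup (hbdd _) ⟨_, (inf_le_right : ψ ⊓ f₁ ≤ f₁), rfl⟩)
            (le_csSup (hbdd _) ⟨_, hχ', rfl⟩)
        · change sSup _ + sSup _ ≤ sSup _
          rw [← csSup_add (hne _) (hbdd _) (hne _) (hbdd _)]
          refine csSup_le ((hne _).add (hne _)) ?_
          rintro _ ⟨_, ⟨ψ₁, h₁, rfl⟩, _, ⟨ψ₂, h₂, rfl⟩, rfl⟩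
          refine le_csSup (hbdd _) ⟨ψ₁ + ψ₂, fun x => add_le_add (h₁ x) (h₂ x), ?_⟩
          simp
      map_smul' := fun a f => by
        refine NNReal.coe_injective (le_antisymm ?_ (hsmul a f))
        change sSup _ ≤ (a : ℝ) * sSup _
        rcases eq_or_ne a 0 with rfl | ha
        · refine csSup_le (hne _) fun y hy => ?_
          have := le_of_mem_valuesBelow hg hc le_rfl (f := (0 : ℝ≥0) • f) (by simp) hy
          simpa using this
        -- The reverse inequality is `hsmul` for the inverse scalar.
        · have h := hsmul a⁻¹ (a • f)
          rw [inv_smul_smul₀ ha, NNReal.coe_inv, inv_mul_le_iff₀ (by positivity)] at h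
          exact h }
  have hΛ : ∀ f : C_c(X, ℝ), 0 ≤ f →
      CompactlySupportedContinuousMap.toRealPositiveLinear Λ f = sSup (valuesBelow g f.nnrealPart)
      ∧ f.nnrealPart.toReal = f := fun f hf => by
    refine ⟨?_, ?_⟩
    · rw [CompactlySupportedContinuousMap.toRealPositiveLinear_apply,
        CompactlySupportedContinuousMap.nnrealPart_neg_eq_zero_of_nonneg hf]
      rw [map_zero, NNReal.coe_zero, sub_zero]
      rfl
    · ext x
      simpa using hf x
  refine ⟨CompactlySupportedContinuousMap.toRealPositiveLinear Λ, fun f hf => ?_, fun f hf h1 => ?_⟩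
  · obtain ⟨h1, h2⟩ := hΛ f hf
    rw [h1]
    exact le_csSup (hbdd _) ⟨_, (le_rfl : f.nnrealPart ≤ f.nnrealPart), congrArg g h2⟩
  · rw [(hΛ f hf).1]
    refine csSup_le (hne _) fun y hy => ?_
    have := le_of_mem_valuesBelow hg hc zero_le_one (fun x => by simpa using h1 x) hy
    simpa using this

variable [T2Space X] [LocallyCompactSpace X] [MeasurableSpace X] [BorelSpace X]

/-- By inner regularity it suffices to bound compact sets, each dominated by a function with values
in `[0, 1]`. -/
lemma isFiniteMeasure_rieszMeasure (L : C_c(X, ℝ) →ₚ[ℝ] ℝ)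
    (hL : ∀ f, 0 ≤ f → (∀ x, f x ≤ 1) → L f ≤ c) : IsFiniteMeasure (RealRMK.rieszMeasure L) := by
  refine ⟨lt_of_le_of_lt ?_ (ENNReal.ofReal_lt_top (r := c))⟩
  rw [isOpen_univ.measure_eq_iSup_isCompact]
  refine iSup_le fun K => iSup_le fun _ => iSup_le fun hK => ?_
  obtain ⟨f, hf1, -, hfc, hf⟩ := exists_continuous_one_zero_of_isCompact hK isClosed_empty
    (disjoint_empty K)
  refine (RealRMK.rieszMeasure_le_of_eq_one L (f := ⟨f, hfc⟩) (fun x => (hf x).1) hK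
    fun x hx => hf1 hx).trans ?_
  exact ENNReal.ofReal_le_ofReal (hL _ (fun x => (hf x).1) fun x => (hf x).2)

/-- The Riesz representation of a bounded functional on `C_c(X, ℝ)` by two finite measures. -/
lemma exists_measures_of_bounded (hg : ∀ f, |g f| ≤ c * supSeminorm X f) (hc : 0 ≤ c) :
    ∃ m₁ m₂ : Measure X, IsFiniteMeasure m₁ ∧ IsFiniteMeasure m₂ ∧
      ∀ f, g f = (∫ x, f x ∂m₁) - ∫ x, f x ∂m₂ := by
  obtain ⟨L, hL, hL1⟩ := exists_positivePart hg hc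
  let L₂ : C_c(X, ℝ) →ₚ[ℝ] ℝ := PositiveLinearMap.mk₀ (L.toLinearMap - g) fun f hf =>
    sub_nonneg.2 (hL f hf)
  have hL₂ : ∀ f, L₂ f = L f - g f := fun f => rfl
  refine ⟨RealRMK.rieszMeasure L, RealRMK.rieszMeasure L₂, isFiniteMeasure_rieszMeasure L hL1,
    isFiniteMeasure_rieszMeasure (c := 2 * c) L₂ fun f hf h1 => ?_, fun f => ?_⟩
  · have h2 := (abs_le.1 (hg f)).1
    have h3 : supSeminorm X f ≤ 1 := supSeminorm_le zero_le_one fun x => by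
      rw [abs_of_nonneg (hf x)]; exact h1 x
    rw [hL₂]
    nlinarith [hL1 f hf h1]
  · rw [RealRMK.integral_rieszMeasure, RealRMK.integral_rieszMeasure, hL₂]; ring

end Riesz

/-! ### The distributional derivative as a measure. -/

namespace IsTestSpace

variable {X : Type*} [MeasureSpace X] [TopologicalSpace X] {T : Set ((X → ℝ) × (X → ℝ))}
  [BorelSpace X] [IsFiniteMeasureOnCompacts (volume : Measure X)]

/-- The functional `φ ↦ -∫ w φ'`. -/
noncomputable def distribDeriv (hT : IsTestSpace T) (w : Lp ℝ 2 (volume : Measure X)) :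
    hT.toSubmodule →ₗ[ℝ] ℝ :=
  -(innerₗ (Lp ℝ 2 (volume : Measure X)) w ∘ₗ hT.derivLp)

lemma distribDeriv_apply (hT : IsTestSpace T) (w : Lp ℝ 2 (volume : Measure X))
    (p : hT.toSubmodule) : hT.distribDeriv w p = -∫ x, w x * p.1.2 x := by
  rw [← hT.inner_derivLp]; rfl

/-- The functional `φ ↦ -∫ w φ'` is bounded by the `L¹(μ)` seminorm. Hahn-Banach extends it to
`L²(μ)` under the same bound, with no density of test functions needed. -/
lemma exists_hasDerivMeasure_of_mem_derivBoundedBy (hT : IsTestSpace T) {μ : Measure X}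
    [IsFiniteMeasure μ] {w : Lp ℝ 2 (volume : Measure X)} (hw : w ∈ hT.derivBoundedBy μ) :
    ∃ ν : SignedMeasure X, HasDerivMeasure T w ν ∧ ν.totalVariation ≤ μ := by
  have hmem : ∀ p : hT.toSubmodule, MemLp p.1.1 2 μ := fun p =>
    (hT.continuous_fst p.2).memLp_of_hasCompactSupport (hT.hasCompactSupport_fst p.2)
  let i : hT.toSubmodule →ₗ[ℝ] Lp ℝ 2 μ :=
    { toFun := fun p => (hmem p).toLp
      map_add' := fun _ _ => MemLp.toLp_add _ _
      map_smul' := fun _ _ => MemLp.toLp_const_smul _ _ }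
  have hi : ∀ f : Lp ℝ 2 μ, Integrable (fun x => |f x|) μ := fun f =>
    ((Lp.memLp f).integrable one_le_two).abs
  let N : Seminorm ℝ (Lp ℝ 2 μ) := Seminorm.of (fun f => ∫ x, |f x| ∂μ)
    (fun f g => by
      rw [← integral_add (hi f) (hi g)]
      refine integral_mono_ae (hi _) ((hi f).add (hi g)) ?_
      filter_upwards [Lp.coeFn_add f g] with x hx
      rw [hx]; exact abs_add_le _ _)
    (fun a f => by
      rw [← integral_const_mul]
      refine integral_congr_ae ?_
      filter_upwards [Lp.coeFn_smul a f] with x hx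
      rw [hx, Pi.smul_apply, smul_eq_mul, abs_mul, Real.norm_eq_abs])
  obtain ⟨g, hg, hgN⟩ := exists_dual_comp_eq_of_le_seminorm (hT.distribDeriv w) i N fun p => by
    have h1 := hw (-p)
    rw [map_neg, inner_neg_right] at h1
    refine h1.trans_eq (integral_congr_ae ?_)
    filter_upwards [(hmem p).coeFn_toLp] with x hx
    simp [i, hx]
  obtain ⟨ν, hν, hνg⟩ := exists_signedMeasure_of_le_integral_abs g hgN
  refine ⟨ν, fun p hp => ?_, hν⟩
  have h2 := hg ⟨p, hp⟩
  rw [hT.distribDeriv_apply] at h2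
  rw [hνg p.1 (hmem ⟨p, hp⟩), eq_neg_iff_add_eq_zero, add_comm, ← eq_neg_iff_add_eq_zero]
  exact h2

/-- Used for `u₀`, where no dominating measure is given yet: finite `TV` is a sup norm bound, which
Riesz-Markov turns into a measure. -/
lemma exists_hasDerivMeasure [T2Space X] [LocallyCompactSpace X] (hT : IsTestSpace T)
    {w : Lp ℝ 2 (volume : Measure X)} (hw : totalVariation T w < ⊤) :
    ∃ ν : SignedMeasure X, HasDerivMeasure T w ν := by
  have h0 := hT.inner_le_totalVariation w hT.zero_mem_unitDerivs
  rw [inner_zero_right] at h0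
  set c := (totalVariation T w).toReal with hc
  have hcTV : (c : EReal) = totalVariation T w :=
    EReal.coe_toReal hw.ne (ne_bot_of_le_ne_bot (by simp) h0)
  have hc0 : 0 ≤ c := by rw [← hcTV] at h0; exact_mod_cast h0
  have hcb : ∀ q ∈ hT.unitDerivs, inner ℝ w q ≤ c := fun q hq => by
    have := hT.inner_le_totalVariation w hq
    rw [← hcTV] at this; exact_mod_cast this
  let i : hT.toSubmodule →ₗ[ℝ] C_c(X, ℝ) :=
    { toFun := fun p => ⟨⟨p.1.1, hT.continuous_fst p.2⟩, hT.hasCompactSupport_fst p.2⟩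
      map_add' := fun _ _ => rfl
      map_smul' := fun _ _ => rfl }
  let c' : ℝ≥0 := ⟨c, hc0⟩
  obtain ⟨g, hg, hgN⟩ := exists_dual_comp_eq_of_le_seminorm (hT.distribDeriv w) i
    (c' • supSeminorm X : Seminorm ℝ C_c(X, ℝ)) fun p => by
    change _ ≤ c * supSeminorm X (i p)
    -- `ε` keeps the normalising factor positive even when the sup norm is `0`.
    have key : ∀ ε : ℝ, 0 < ε → hT.distribDeriv w p ≤ c * (supSeminorm X (i p) + ε) := by
      intro ε hε
      have hM : 0 < supSeminorm X (i p) + ε := add_pos_of_nonneg_of_pos (apply_nonneg _ _) hε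
      have h1 := hcb _ ⟨-((supSeminorm X (i p) + ε)⁻¹ • p), fun x => ?_, rfl⟩
      · rw [map_neg, map_smul, inner_neg_right, inner_smul_right, ← mul_neg,
          inv_mul_le_iff₀ hM] at h1
        rw [mul_comm]; exact h1
      · have h2 : |p.1.1 x| ≤ supSeminorm X (i p) := abs_le_supSeminorm (i p) x
        have h3 : |(supSeminorm X (i p) + ε)⁻¹ * p.1.1 x| ≤ 1 := by
          rw [abs_mul, abs_of_pos (inv_pos.2 hM), inv_mul_le_iff₀ hM]
          linarith
        simpa using h3
    refine ge_of_tendsto (x := 𝓝[>] (0 : ℝ)) (Tendsto.mono_left ?_ nhdsWithin_le_nhds)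
      (eventually_nhdsWithin_of_forall key)
    exact Continuous.tendsto' (by fun_prop) _ _ (by simp)
  obtain ⟨m₁, m₂, hm₁, hm₂, hm⟩ := exists_measures_of_bounded (c := c) hgN hc0
  refine ⟨m₁.toSignedMeasure - m₂.toSignedMeasure, fun p hp => ?_⟩
  rw [signedIntegral_toSignedMeasure_sub (hT.integrable_fst hp) (hT.integrable_fst hp)]
  have h2 := (hg ⟨p, hp⟩).symm.trans (hm _)
  rw [hT.distribDeriv_apply] at h2
  exact neg_eq_iff_eq_neg.1 h2

lemma mem_derivBoundedBy_of_hasDerivMeasure (hT : IsTestSpace T)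
    {w : Lp ℝ 2 (volume : Measure X)} {ν : SignedMeasure X} (hν : HasDerivMeasure T w ν) :
    w ∈ hT.derivBoundedBy ν.totalVariation := by
  intro p
  rw [hT.inner_derivLp, hν p.1 p.2, signedIntegral, SignedMeasure.totalVariation,
    integral_add_measure (hT.integrable_fst p.2).abs (hT.integrable_fst p.2).abs]
  have h1 := (abs_le.1 (abs_integral_le_integral_abs (f := p.1.1)
    (μ := ν.toJordanDecomposition.posPart))).1
  have h2 := (abs_le.1 (abs_integral_le_integral_abs (f := p.1.1)
    (μ := ν.toJordanDecomposition.negPart))).2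
  linarith

/-- The total variation flow does not increase the derivative of the initial datum. -/
theorem exists_totalVariation_le [T2Space X] [LocallyCompactSpace X] (hT : IsTestSpace T)
    {u₀ : Lp ℝ 2 (volume : Measure X)} {u : ℝ → Lp ℝ 2 (volume : Measure X)}
    (h0 : totalVariation T u₀ < ⊤) (hu : IsTVFlow T u₀ u) :
    ∃ ν₀ : SignedMeasure X, HasDerivMeasure T u₀ ν₀ ∧
      ∀ t : ℝ, 0 < t → ∃ ν : SignedMeasure X,
        HasDerivMeasure T (u t) ν ∧ ν.totalVariation ≤ ν₀.totalVariation := by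
  obtain ⟨ν₀, hν₀⟩ := hT.exists_hasDerivMeasure h0
  have : IsFiniteMeasure ν₀.totalVariation := by
    rw [SignedMeasure.totalVariation]; infer_instance
  exact ⟨ν₀, hν₀, fun t ht => hT.exists_hasDerivMeasure_of_mem_derivBoundedBy
    (hT.mem_derivBoundedBy_of_isTVFlow hu (hT.mem_derivBoundedBy_of_hasDerivMeasure hν₀) ht.le)⟩

end IsTestSpace

end TVFlow

/-! ### Intervals and circles as test spaces. -/

namespace TVFlow

lemma hasDerivAt_mul_comp {φ ψ g : ℝ → ℝ} (hφ : ContDiff ℝ ∞ φ) (hψ : ContDiff ℝ ∞ ψ)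
    (hg : ContDiff ℝ ∞ g) (x : ℝ) : HasDerivAt (fun y => φ y * g (ψ y))
      (deriv φ x * g (ψ x) + φ x * (deriv g (ψ x) * deriv ψ x)) x :=
  have hd : ∀ {f : ℝ → ℝ}, ContDiff ℝ ∞ f → ∀ y, HasDerivAt f (deriv f y) y := fun hf y =>
    (hf.differentiable (by simp) y).hasDerivAt
  (hd hφ x).mul ((hd hg (ψ x)).comp x (hd hψ x))

lemma isTestSpace_intervalTests {Ω : Set ℝ} (hΩ : IsOpen Ω) : IsTestSpace (intervalTests Ω) where
  continuous_fst := by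
    rintro p ⟨φ, hφ, -, -, h1, -⟩
    rw [funext h1]
    exact hφ.continuous.comp continuous_subtype_val
  hasCompactSupport_fst := by
    rintro p ⟨φ, hφ, hc, hs, h1, -⟩
    refine HasCompactSupport.of_support_subset_isCompact
      (Topology.IsInducing.subtypeVal.isCompact_preimage' hc.isCompact (by simpa using hs))
      fun x hx => ?_
    rw [Function.mem_support, h1] at hx
    exact subset_tsupport φ hx
  zero_mem := ⟨0, contDiff_const, HasCompactSupport.zero, by simp [tsupport], fun _ => rfl,
    fun x => by simp⟩
  add_mem := by
    rintro p q ⟨φ, hφ, hc, hs, h1, h2⟩ ⟨ψ, hψ, hc', hs', h1', h2'⟩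
    refine ⟨φ + ψ, hφ.add hψ, hc.add hc', (tsupport_add φ ψ).trans (union_subset hs hs'),
      fun x => by simp [h1, h1'], fun x => ?_⟩
    rw [deriv_add (hφ.differentiable (by simp) _) (hψ.differentiable (by simp) _)]
    simp [h2, h2']
  smul_mem := by
    rintro c p ⟨φ, hφ, hc, hs, h1, h2⟩
    refine ⟨fun x => c * φ x, contDiff_const.mul hφ, hc.mul_left,
      (tsupport_mul_subset_right).trans hs, fun x => by simp [h1], fun x => ?_⟩
    rw [deriv_const_mul _ (hφ.differentiable (by simp) _)]
    simp [h2]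
  mul_comp_mem := by
    rintro p q g ⟨φ, hφ, hc, hs, h1, h2⟩ ⟨ψ, hψ, -, -, h1', h2'⟩ hg
    refine ⟨fun x => φ x * g (ψ x), hφ.mul (hg.comp hψ), hc.mul_right,
      tsupport_mul_subset_left.trans hs, fun x => by simp [h1, h1'], fun x => ?_⟩
    rw [(hasDerivAt_mul_comp hφ hψ hg x).deriv]
    simp [h1, h2, h1', h2']
  exists_deriv_mem := by
    rintro p ⟨φ, hφ, hc, hs, -, h2⟩
    exact ⟨fun x => deriv (deriv φ) x, deriv φ, (contDiff_infty_iff_deriv.1 hφ).2, hc.deriv,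
      (closure_minimal (support_deriv_subset) (isClosed_tsupport φ)).trans hs, h2, fun _ => rfl⟩
  integral_deriv := by
    rintro p ⟨φ, hφ, hc, hs, -, h2⟩
    have hc1 : Continuous (deriv φ) := (contDiff_infty_iff_deriv.1 hφ).2.continuous
    rw [funext h2]
    have h3 : ∫ x : Ω, deriv φ x = ∫ x in Ω, deriv φ x :=
      integral_subtype_comap hΩ.measurableSet _
    rw [h3, setIntegral_eq_integral_of_forall_compl_eq_zero]
    · exact integral_eq_zero_of_hasDerivAt_of_integrable
        (fun x => (hφ.differentiable (by simp) x).hasDerivAt)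
        (hc1.integrable_of_hasCompactSupport hc.deriv)
        (hφ.continuous.integrable_of_hasCompactSupport hc)
    · intro x hx
      by_contra h
      exact hx (hs (support_deriv_subset h))
  exists_cutoff := by
    rintro p ⟨φ, hφ, hc, hs, h1, -⟩
    obtain ⟨K, hK, hφK, hKΩ⟩ := exists_compact_between hc.isCompact hΩ hs
    obtain ⟨f, hf1, hf0, hf⟩ := exists_contMDiffMap_one_nhds_of_subset_interior (n := ⊤)
      (modelWithCornersSelf ℝ ℝ) (isClosed_tsupport φ) hφK
    have hfK : Function.support f ⊆ K := fun x hx => by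
      by_contra h
      exact hx (hf0 x h)
    refine ⟨(fun x => f x, fun x => deriv f x), ⟨f, f.contMDiff.contDiff,
      HasCompactSupport.of_support_subset_isCompact hK hfK,
      (closure_minimal hfK hK.isClosed).trans hKΩ, fun _ => rfl, fun _ => rfl⟩,
      fun x => (hf x).1, fun x => (hf x).2, fun x hx => ?_⟩
    rw [h1] at hx
    exact hf1.self_of_nhdsSet _ (subset_tsupport φ hx)

lemma isTestSpace_circleTests (L : ℝ) [Fact (0 < L)] : IsTestSpace (circleTests L) where
  continuous_fst := by
    rintro p ⟨h1, -⟩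
    exact (QuotientAddGroup.isQuotientMap_mk _).continuous_iff.2 h1.continuous
  hasCompactSupport_fst _ := HasCompactSupport.of_compactSpace _
  zero_mem := ⟨contDiff_const, fun x => by simp⟩
  add_mem := by
    rintro p q ⟨h1, h2⟩ ⟨h1', h2'⟩
    refine ⟨h1.add h1', fun x => ?_⟩
    have := deriv_fun_add (h1.differentiable (by simp) x) (h1'.differentiable (by simp) x)
    simp only [Prod.snd_add, Prod.fst_add, Pi.add_apply, h2, h2']
    exact this.symm
  smul_mem := by
    rintro c p ⟨h1, h2⟩
    refine ⟨contDiff_const.mul h1, fun x => ?_⟩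
    simp [h2]
  mul_comp_mem := by
    rintro p q g ⟨h1, h2⟩ ⟨h1', h2'⟩ hg
    refine ⟨h1.mul (hg.comp h1'), fun x => ?_⟩
    have := (hasDerivAt_mul_comp h1 h1' hg x).deriv
    simp only [h2, h2']
    exact this.symm
  exists_deriv_mem := by
    rintro p ⟨h1, h2⟩
    have h3 : (fun x : ℝ => p.2 (x : AddCircle L)) =
      deriv fun y : ℝ => p.1 (y : AddCircle L) := funext h2
    have hper : Function.Periodic (deriv fun y : ℝ => p.2 (y : AddCircle L)) L := fun x => by
      rw [← deriv_comp_add_const]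
      simp
    exact ⟨hper.lift, h3 ▸ (contDiff_infty_iff_deriv.1 h1).2, fun x => hper.lift_coe x⟩
  integral_deriv := by
    rintro p ⟨h1, h2⟩
    rw [← AddCircle.intervalIntegral_preimage L 0, intervalIntegral.integral_congr fun x _ => h2 x,
      intervalIntegral.integral_deriv_eq_sub (fun x _ => h1.differentiable (by simp) x)
      ((contDiff_infty_iff_deriv.1 h1).2.continuous.intervalIntegrable _ _)]
    simp [AddCircle.coe_period]
  -- The circle is compact, so the constant `1` is itself a test function.
  exists_cutoff _ := ⟨(fun _ => 1, fun _ => 0), ⟨contDiff_const, fun x => by simp⟩,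
    fun _ => zero_le_one, fun _ => le_rfl, fun _ _ => rfl⟩

end TVFlow

theorem mainTheorem2 :
    -- open intervals `Ω ⊆ ℝ`, bounded or not
    (∀ Ω : Set ℝ, IsOpen Ω → Ω.OrdConnected → Ω.Nonempty →
      ∀ (u₀ : Lp ℝ 2 (volume : Measure Ω)) (u : ℝ → Lp ℝ 2 (volume : Measure Ω)),
        TVFlow.totalVariation (TVFlow.intervalTests Ω) u₀ < ⊤ →
        TVFlow.IsTVFlow (TVFlow.intervalTests Ω) u₀ u →
        ∃ ν₀ : SignedMeasure Ω,
          TVFlow.HasDerivMeasure (TVFlow.intervalTests Ω) u₀ ν₀ ∧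
          ∀ t : ℝ, 0 < t → ∃ ν : SignedMeasure Ω,
            TVFlow.HasDerivMeasure (TVFlow.intervalTests Ω) (u t) ν ∧
            ν.totalVariation ≤ ν₀.totalVariation) ∧
    -- the periodic case `Ω = ℝ/Lℤ`
    (∀ (L : ℝ) [Fact (0 < L)]
      (u₀ : Lp ℝ 2 (volume : Measure (AddCircle L)))
      (u : ℝ → Lp ℝ 2 (volume : Measure (AddCircle L))),
        TVFlow.totalVariation (TVFlow.circleTests L) u₀ < ⊤ →
        TVFlow.IsTVFlow (TVFlow.circleTests L) u₀ u →
        ∃ ν₀ : SignedMeasure (AddCircle L),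
          TVFlow.HasDerivMeasure (TVFlow.circleTests L) u₀ ν₀ ∧
          ∀ t : ℝ, 0 < t → ∃ ν : SignedMeasure (AddCircle L),
            TVFlow.HasDerivMeasure (TVFlow.circleTests L) (u t) ν ∧
            ν.totalVariation ≤ ν₀.totalVariation) := by
  refine ⟨fun Ω hΩ _ _ u₀ u h0 hu => ?_, fun L _ u₀ u h0 hu =>
    (TVFlow.isTestSpace_circleTests L).exists_totalVariation_le h0 hu⟩
  have : IsFiniteMeasureOnCompacts (volume : Measure Ω) :=
    IsFiniteMeasureOnCompacts.comap' volume continuous_subtype_val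
      (MeasurableEmbedding.subtype_coe hΩ.measurableSet)
  have : LocallyCompactSpace Ω := hΩ.locallyCompactSpace
  exact (TVFlow.isTestSpace_intervalTests hΩ).exists_totalVariation_le h0 hu
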